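/- A \emph{parametrically weighted graph} is a finite connected simple undirected graph each of whose edges $e$ is labelled by a linear function $\lambda\mapsto a_e\lambda+b_e$ ($a_e,b_e\in\mathbb{R}$) of a real parameter $\lambda$. Its \emph{parametric minimum spanning trees} are the spanning trees $T$ for which there is a $\lambda\in\mathbb{R}$ such that $T$ is the unique spanning tree of minimum total weight when every edge $e$ has weight $a_e\lambda+b_e$. \textbf{Theorem.} There is a constant $C>0$ such that for all integers $n>0$ and $m\ge 0$ with $2n-3\le m\le\binom{n}{2}$, there exists a parametrically weighted graph with $n$ vertices and $m$ edges that has at least $C\,m\log n$ distinct parametric minimum spanning trees. -/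

import Mathlib

/-- `T` is a spanning tree of `G`: a tree on the whole vertex set, all of whose edges are
edges of `G`. -/
def IsSpanningTree {V : Type*} (G T : SimpleGraph V) : Prop :=
  T ≤ G ∧ T.IsTree

open Classical in
/-- The total weight of a finite graph `T` under the edge weights `w`. -/
noncomputable def totalWeight {V : Type*} [Fintype V] (w : Sym2 V → ℝ)
    (T : SimpleGraph V) : ℝ :=
  ∑ e ∈ T.edgeFinset, w e

/-- `T` is the unique minimum spanning tree of `G` for the edge weights `w`: it is a spanning
tree, and every other spanning tree has strictly larger total weight.
Only the values of `w` on edges of `G` matter. -/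
def IsUniqueMinSpanningTree {V : Type*} [Fintype V] (G : SimpleGraph V) (w : Sym2 V → ℝ)
    (T : SimpleGraph V) : Prop :=
  IsSpanningTree G T ∧
    ∀ T' : SimpleGraph V, IsSpanningTree G T' → T' ≠ T → totalWeight w T < totalWeight w T'

/-- An instance of the parametric minimum spanning tree problem on the vertex set `V`: a
connected graph, each of whose edges `e` is labelled by the linear function
`t ↦ slope e * t + intercept e` of the real parameter `t`. (Values of `slope` and `intercept`
at pairs that are not edges are never used.) -/
structure ParametricGraph (V : Type*) where
  graph : SimpleGraph V
  connected : graph.Connected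
  slope : Sym2 V → ℝ
  intercept : Sym2 V → ℝ

namespace ParametricGraph

/-- The real edge weights obtained by evaluating the labels at the parameter value `t`. -/
def weightAt {V : Type*} (P : ParametricGraph V) (t : ℝ) (e : Sym2 V) : ℝ :=
  P.slope e * t + P.intercept e

/-- The set of parametric minimum spanning trees: the trees that are the unique minimum spanning
tree for some value of the parameter (and hence, by continuity, on an open interval of values).
Requiring uniqueness makes the set well defined however ties are broken: a tree which is minimum
only because of ties between edge weights is not counted. -/
def minSpanningTrees {V : Type*} [Fintype V] (P : ParametricGraph V) : Set (SimpleGraph V) :=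
  {T | ∃ t : ℝ, IsUniqueMinSpanningTree P.graph (P.weightAt t) T}

end ParametricGraph

/-!
A network with `N = 4 ^ j` edges whose minimum spanning tree changes of the order of `N * log N`
times is obtained by doubling a single edge `2 * j` times, alternately in series and in parallel. The
edge weights are arranged so that each of the `N` edges is, at its own time, the bottleneck edge
between the two terminals, in the order of their numbers. This property survives a doubling
(`exists_lines`): one copy keeps its lines, and in the other copy the line of each edge is tilted a
little about its point at the time of that edge, so that just there the bottleneck passes from the one
copy to the other. The tree with bottleneck edge `t` contains an edge `x ≠ t` according to the parity
of the first binary digit in which `t` and `x` differ (`inTree_iff`, `outTree_iff`). When `t` increases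
by one, a carry may move this digit for many `x` at once, and altogether at least `j * 4 ^ (j - 1)`
edges leave the tree (`card_leaving`). For distinct
weights the tree is described by cuts (`mem_kruskalTree_iff`,
`isUniqueMinSpanningTree_kruskalTree`), which is how `inTree_iff` is transferred to any
graph in which all other edges are heavier (`netEdge_mem_kruskalTree_iff`).

After a generic perturbation of the intercepts (`exists_generic_intercepts`), at most one pair of lines
meets at a time, so that at most one edge leaves the tree at a time. As a tree that has been left is
never met again, the number of trees exceeds the total number of edges that leave between sample
values (`ParametricGraph.sum_ncard_diff_lt_ncard_minSpanningTrees`).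

As `m` may be much larger than `n`, of the order of `m / n` copies of a network of size proportional to
`n` are put on the same vertices. The network is 2-degenerate, so its vertices can
be labelled greedily by integers of linear size with different label differences on all edges
(`exists_labelling`), and the translates of this placement are edge-disjoint. The copies become active
in disjoint windows of the parameter: the lines of each follow a different tangent of a concave
parabola, and are the lightest near the point of contact (`window_separation`, `exists_weights`).
Further heavy edges complete a spanning star, which makes the graph connected, and bring the number of
edges to `m`.
-/

/-! ### Minimum spanning trees for distinct weights -/

section Kruskal

variable {V : Type*}

/-- The subgraph of `G` formed by the edges of weight less than `θ`. -/
def lighterGraph (G : SimpleGraph V) (w : Sym2 V → ℝ) (θ : ℝ) : SimpleGraph V :=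
  SimpleGraph.fromEdgeSet {e | e ∈ G.edgeSet ∧ w e < θ}

/-- The edges of `G` whose endpoints are not connected by strictly lighter edges. If the edges of
a connected graph have distinct weights, this is its unique minimum spanning tree. -/
def kruskalTree (G : SimpleGraph V) (w : Sym2 V → ℝ) : SimpleGraph V where
  Adj u v := G.Adj u v ∧ ¬ (lighterGraph G w (w s(u, v))).Reachable u v
  symm := ⟨fun u v h => ⟨h.1.symm, fun hr => h.2 (by rw [Sym2.eq_swap]; exact hr.symm)⟩⟩
  loopless := ⟨fun u h => G.loopless.irrefl u h.1⟩

lemma lighterGraph_adj {G : SimpleGraph V} {w : Sym2 V → ℝ} {θ : ℝ} {u v : V} :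
    (lighterGraph G w θ).Adj u v ↔ G.Adj u v ∧ w s(u, v) < θ := by
  simp only [lighterGraph, SimpleGraph.fromEdgeSet_adj, Set.mem_ofPred_eq, SimpleGraph.mem_edgeSet]
  exact ⟨fun h => h.1, fun h => ⟨h, h.1.ne⟩⟩

lemma kruskalTree_le (G : SimpleGraph V) (w : Sym2 V → ℝ) : kruskalTree G w ≤ G :=
  fun _ _ h => h.1

lemma reachable_iff_forall_coloring {H : SimpleGraph V} {u v : V} :
    H.Reachable u v ↔ ∀ c : V → Bool, (∀ a b, H.Adj a b → c a = c b) → c u = c v := by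
  classical
  constructor
  · rintro ⟨p⟩ c hc
    induction p with
    | nil => rfl
    | cons h _ ih => exact (hc _ _ h).trans ih
  · intro h
    have := h (fun x => decide (H.Reachable u x)) (fun a b hab => by
      simp only [decide_eq_decide]
      exact ⟨fun h => h.trans hab.reachable, fun h => h.trans hab.symm.reachable⟩)
    simpa using this

/-- An edge is in the minimum spanning tree if and only if some cut separates its endpoints
without separating the endpoints of any lighter edge. -/
lemma mem_kruskalTree_iff {G : SimpleGraph V} {w : Sym2 V → ℝ} {u v : V} :
    s(u, v) ∈ (kruskalTree G w).edgeSet ↔ G.Adj u v ∧ ∃ c : V → Bool,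
      (∀ a b, G.Adj a b → w s(a, b) < w s(u, v) → c a = c b) ∧ c u ≠ c v := by
  rw [SimpleGraph.mem_edgeSet]
  change (_ ∧ ¬ _) ↔ _
  rw [reachable_iff_forall_coloring]
  simp only [lighterGraph_adj, and_imp, not_forall, exists_prop, ne_eq]

lemma mem_kruskalTree_congr {G : SimpleGraph V} {w w' : Sym2 V → ℝ} {e : Sym2 V}
    (h : ∀ f ∈ G.edgeSet, w f < w e ↔ w' f < w' e) (he : e ∈ (kruskalTree G w).edgeSet) :
    e ∈ (kruskalTree G w').edgeSet := by
  induction e with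
  | _ u v =>
    rw [mem_kruskalTree_iff] at he ⊢
    obtain ⟨h1, c, h2, h3⟩ := he
    exact ⟨h1, c, fun a b hab hw => h2 a b hab ((h _ hab).2 hw), h3⟩

variable [Fintype V]

lemma SimpleGraph.IsAcyclic.isTree_of_ncard {T H : SimpleGraph V} (hT : T.IsTree)
    (hH : H.IsAcyclic) (hc : T.edgeSet.ncard ≤ H.edgeSet.ncard) : H.IsTree := by
  have hV : Nonempty V := hT.1.nonempty
  obtain ⟨S, hHS, -, hS⟩ := (SimpleGraph.connected_top (V := V)).exists_isTree_le_of_le_of_isAcyclic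
    (le_top : H ≤ ⊤) hH
  have h1 := (SimpleGraph.isTree_iff_connected_and_card.1 hT).2
  have h2 := (SimpleGraph.isTree_iff_connected_and_card.1 hS).2
  rw [Nat.card_coe_set_eq] at h1 h2
  have h3 : H.edgeSet = S.edgeSet :=
    Set.eq_of_subset_of_ncard_le (SimpleGraph.edgeSet_subset_edgeSet.2 hHS) (by omega)
      (Set.toFinite _)
  rwa [SimpleGraph.edgeSet_inj.1 h3]

lemma totalWeight_eq (w : Sym2 V → ℝ) (T : SimpleGraph V) :
    totalWeight w T = ∑ e ∈ (Set.toFinite T.edgeSet).toFinset, w e := by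
  unfold totalWeight
  congr 1
  ext e
  simp

/-- Exchanging a tree edge `s(x, y)` for an edge `s(u, v)` across the cut that it leaves gives
another spanning tree, whose weight differs by the weights of these two edges. -/
lemma exists_exchange {G T : SimpleGraph V} (hT : IsSpanningTree G T) {x y u v : V}
    (hxy : T.Adj x y) (huv : G.Adj u v) (hsep : ¬ (T.deleteEdges {s(x, y)}).Reachable u v)
    (w : Sym2 V → ℝ) :
    ∃ T', IsSpanningTree G T' ∧ totalWeight w T' = totalWeight w T - w s(x, y) + w s(u, v) := by
  classical
  set D := T.deleteEdges {s(x, y)} with hD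
  have hDT : D ≤ T := SimpleGraph.deleteEdges_le _
  have hac : (D ⊔ SimpleGraph.edge u v).IsAcyclic :=
    (hT.2.2.anti hDT).sup_edge_of_not_reachable hsep
  have hnot : s(u, v) ∉ D.edgeSet := fun h => hsep (SimpleGraph.Adj.reachable h)
  have hE : (D ⊔ SimpleGraph.edge u v).edgeSet = insert s(u, v) (T.edgeSet \ {s(x, y)}) := by
    rw [SimpleGraph.edgeSet_sup, SimpleGraph.edgeSet_edge_of_ne huv.ne, hD,
      SimpleGraph.edgeSet_deleteEdges, Set.union_singleton]
  have hnot' : s(u, v) ∉ T.edgeSet \ {s(x, y)} := by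
    rwa [hD, SimpleGraph.edgeSet_deleteEdges] at hnot
  refine ⟨_, ⟨?_, hac.isTree_of_ncard hT.2 ?_⟩, ?_⟩
  · exact sup_le (hDT.trans hT.1) ((SimpleGraph.edge_le_iff _).2 (Or.inr huv))
  · rw [hE, Set.ncard_insert_of_notMem hnot' (Set.toFinite _),
      Set.ncard_sdiff_singleton_add_one ((SimpleGraph.mem_edgeSet T).2 hxy) (Set.toFinite _)]
  · rw [totalWeight_eq, totalWeight_eq]
    have h1 : (Set.toFinite (D ⊔ SimpleGraph.edge u v).edgeSet).toFinset =
        insert s(u, v) ((Set.toFinite T.edgeSet).toFinset.erase s(x, y)) := by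
      ext e
      simp only [Set.Finite.mem_toFinset, hE, Finset.mem_insert, Finset.mem_erase, Set.mem_insert_iff,
        Set.mem_sdiff, Set.mem_singleton_iff]
      tauto
    have hm : s(x, y) ∈ (Set.toFinite T.edgeSet).toFinset := by simpa using hxy
    rw [h1, Finset.sum_insert, ← Finset.add_sum_erase _ _ hm]
    · ring
    · simpa [and_comm] using hnot'

/-- A spanning tree of minimum weight is the tree of edges whose endpoints are not connected by
lighter edges: otherwise an exchange would improve it. -/
lemma eq_kruskalTree_of_forall_le {G T : SimpleGraph V} {w : Sym2 V → ℝ}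
    (hw : Set.InjOn w G.edgeSet) (hT : IsSpanningTree G T)
    (hmin : ∀ T', IsSpanningTree G T' → totalWeight w T ≤ totalWeight w T') :
    T = kruskalTree G w := by
  classical
  apply le_antisymm
  · intro u v huv
    refine ⟨hT.1 huv, fun hr => ?_⟩
    have hsep : ¬ (T.deleteEdges {s(u, v)}).Reachable u v := by
      have := SimpleGraph.isAcyclic_iff_forall_adj_isBridge.1 hT.2.2 huv
      exact (SimpleGraph.isBridge_iff.1 this)
    -- Some lighter edge joins the two sides of the cut left by `s(u, v)`.
    obtain ⟨a, b, hab, hsab⟩ : ∃ a b, (lighterGraph G w (w s(u, v))).Adj a b ∧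
        ¬ (T.deleteEdges {s(u, v)}).Reachable a b := by
      by_contra! hcon
      apply hsep
      obtain ⟨p⟩ := hr
      clear hsep
      generalize (lighterGraph G w (w s(u, v))) = H at *
      generalize (T.deleteEdges {s(u, v)}) = D at *
      clear huv
      induction p with
      | nil => exact SimpleGraph.Reachable.refl _
      | cons h _ ih => exact (hcon _ _ h).trans ih
    rw [lighterGraph_adj] at hab
    obtain ⟨T', hT', hwt⟩ := exists_exchange hT huv hab.1 hsab w
    linarith [hmin T' hT', hab.2]
  · intro u v huv
    by_contra hnot
    obtain ⟨p, hp⟩ := hT.2.1.exists_isPath u v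
    obtain ⟨f, hf, hwf⟩ : ∃ f ∈ p.edges, w s(u, v) ≤ w f := by
      by_contra! hcon
      apply huv.2
      refine ⟨p.transfer _ ?_⟩
      intro e he
      have h1 := p.edges_subset_edgeSet he
      have h2 := hcon e he
      induction e with
      | _ a b => exact lighterGraph_adj.2 ⟨hT.1 h1, h2⟩
    have hfT := p.edges_subset_edgeSet hf
    induction f with
    | _ x y =>
      have hne : s(u, v) ≠ s(x, y) := fun h => hnot (by
        rw [← SimpleGraph.mem_edgeSet, h]; exact hfT)
      have hsep : ¬ (T.deleteEdges {s(x, y)}).Reachable u v := by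
        rintro hr
        obtain ⟨q, hq⟩ := hr.exists_isPath
        have hle : T.deleteEdges {s(x, y)} ≤ T := SimpleGraph.deleteEdges_le _
        have heq := (hT.2.2.subsingleton_path u v).elim ⟨p, hp⟩ ⟨q.mapLe hle, hq.mapLe hle⟩
        have heq' : p = q.mapLe hle := congrArg Subtype.val heq
        rw [heq', SimpleGraph.Walk.edges_mapLe_eq_edges] at hf
        have := q.edges_subset_edgeSet hf
        simp at this
      obtain ⟨T', hT', hwt⟩ := exists_exchange hT hfT huv.1 hsep w
      have hlt : w s(u, v) < w s(x, y) :=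
        lt_of_le_of_ne hwf (fun h => hne (hw huv.1 (hT.1 hfT) h))
      linarith [hmin T' hT']

theorem isUniqueMinSpanningTree_kruskalTree {G : SimpleGraph V} (hG : G.Connected)
    {w : Sym2 V → ℝ} (hw : Set.InjOn w G.edgeSet) :
    IsUniqueMinSpanningTree G w (kruskalTree G w) := by
  classical
  obtain ⟨T₀, hT₀⟩ := hG.exists_isTree_le
  obtain ⟨T, hT, hmin⟩ := Set.exists_min_image {T | IsSpanningTree G T} (totalWeight w)
    (Set.toFinite _) ⟨T₀, hT₀⟩
  obtain rfl := eq_kruskalTree_of_forall_le hw hT hmin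
  refine ⟨hT, fun T' hT' hne => lt_of_le_of_ne (hmin T' hT') fun heq => hne ?_⟩
  exact eq_kruskalTree_of_forall_le hw hT' (fun S hS => heq ▸ hmin S hS)

end Kruskal

/-! ### Counting the trees met along the parameter line -/

namespace ParametricGraph

variable {V : Type*}

/-- No two edges of `P` have the same weight at the parameter value `t`. -/
def NoTie (P : ParametricGraph V) (t : ℝ) : Prop :=
  Set.InjOn (P.weightAt t) P.graph.edgeSet

/-- At every parameter value, at most one pair of edges has equal weights. -/
def Generic (P : ParametricGraph V) : Prop :=
  ∀ t : ℝ, ∀ e ∈ P.graph.edgeSet, ∀ f ∈ P.graph.edgeSet, ∀ g ∈ P.graph.edgeSet,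
    ∀ h ∈ P.graph.edgeSet, e ≠ f → g ≠ h → P.weightAt t e = P.weightAt t f →
      P.weightAt t g = P.weightAt t h → (e = g ∧ f = h) ∨ (e = h ∧ f = g)

/-- The minimum spanning tree at the parameter value `t`, if there are no ties. -/
def treeAt (P : ParametricGraph V) (t : ℝ) : SimpleGraph V :=
  kruskalTree P.graph (P.weightAt t)

/-- The minimum spanning trees met on the parameter interval `[a, b]`. -/
def treesOn (P : ParametricGraph V) (a b : ℝ) : Set (SimpleGraph V) :=
  {T | ∃ t, a ≤ t ∧ t ≤ b ∧ P.NoTie t ∧ T = P.treeAt t}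

variable {P : ParametricGraph V}

lemma exists_tie_between {a b : ℝ} {e f : Sym2 V} (hab : a ≤ b)
    (ha : P.weightAt a e < P.weightAt a f) (hb : P.weightAt b f < P.weightAt b e) :
    ∃ t, a < t ∧ t < b ∧ P.weightAt t e = P.weightAt t f := by
  have hc : ContinuousOn (fun t => P.weightAt t e - P.weightAt t f) (Set.Icc a b) := by
    unfold weightAt; fun_prop
  obtain ⟨t, ht, h0⟩ := intermediate_value_Ioo hab hc
    (show (0 : ℝ) ∈ Set.Ioo _ _ from ⟨by simpa using ha, by simpa using hb⟩)
  exact ⟨t, ht.1, ht.2, by simpa [sub_eq_zero] using h0⟩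

lemma treeAt_mem_treesOn {a b t : ℝ} (h : P.NoTie t) (h1 : a ≤ t) (h2 : t ≤ b) :
    P.treeAt t ∈ P.treesOn a b := ⟨t, h1, h2, h, rfl⟩

variable [Fintype V]

lemma NoTie.isUniqueMin {t : ℝ} (h : P.NoTie t) :
    IsUniqueMinSpanningTree P.graph (P.weightAt t) (P.treeAt t) :=
  isUniqueMinSpanningTree_kruskalTree P.connected h

lemma treesOn_subset (a b : ℝ) : P.treesOn a b ⊆ P.minSpanningTrees := by
  rintro _ ⟨t, -, -, ht, rfl⟩
  exact ⟨t, ht.isUniqueMin⟩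

lemma totalWeight_weightAt (t : ℝ) (T : SimpleGraph V) :
    totalWeight (P.weightAt t) T = totalWeight P.slope T * t + totalWeight P.intercept T := by
  simp only [totalWeight, weightAt, Finset.sum_add_distrib, Finset.sum_mul]

/-- The parameter values at which a given tree is the minimum spanning tree form a convex set. -/
lemma treeAt_eq_of_between {a b c : ℝ} (ha : P.NoTie a) (hb : P.NoTie b) (hc : P.NoTie c)
    (hab : a ≤ b) (hbc : b ≤ c) (h : P.treeAt a = P.treeAt c) : P.treeAt b = P.treeAt a := by
  by_contra hne
  have h1 := ha.isUniqueMin.2 _ hb.isUniqueMin.1 hne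
  have h2 := hc.isUniqueMin.2 _ hb.isUniqueMin.1 (h ▸ hne)
  have h3 := hb.isUniqueMin.2 _ ha.isUniqueMin.1 (Ne.symm hne)
  rw [← h] at h2
  simp only [totalWeight_weightAt] at h1 h2 h3
  set x := totalWeight P.slope (P.treeAt a)
  set y := totalWeight P.slope (P.treeAt b)
  rcases le_total x y with hxy | hxy
  · nlinarith [mul_nonneg (sub_nonneg.2 hxy) (sub_nonneg.2 hab)]
  · nlinarith [mul_nonneg (sub_nonneg.2 hxy) (sub_nonneg.2 hbc)]

lemma ncard_treesOn_add_le {a b c : ℝ} (hb : P.NoTie b) (hab : a ≤ b) (hbc : b ≤ c) :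
    (P.treesOn a b).ncard + (P.treesOn b c).ncard ≤ (P.treesOn a c).ncard + 1 := by
  classical
  have h1 : P.treesOn a b ∪ P.treesOn b c ⊆ P.treesOn a c := by
    rintro T (⟨t, h1, h2, h3⟩ | ⟨t, h1, h2, h3⟩)
    · exact ⟨t, h1, h2.trans hbc, h3⟩
    · exact ⟨t, hab.trans h1, h2, h3⟩
  have h2 : P.treesOn a b ∩ P.treesOn b c ⊆ {P.treeAt b} := by
    rintro T ⟨⟨t, h1, h2, h3, rfl⟩, ⟨t', h1', h2', h3', heq⟩⟩
    exact (treeAt_eq_of_between h3 hb h3' h2 h1' heq).symm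
  have h3 := Set.ncard_le_ncard h1 (Set.toFinite _)
  have h4 := Set.ncard_le_ncard h2 (Set.toFinite _)
  rw [Set.ncard_singleton] at h4
  have h5 := Set.ncard_union_add_ncard_inter (P.treesOn a b) (P.treesOn b c)
    (Set.toFinite _) (Set.toFinite _)
  omega

lemma finite_tie {t₀ : ℝ} (h₀ : P.NoTie t₀) : {t | ¬ P.NoTie t}.Finite := by
  -- Two edges that tie at `t` have different slopes, since they do not tie at `t₀`.
  refine Set.Finite.subset (Set.finite_range (fun p : Sym2 V × Sym2 V =>
    (P.intercept p.2 - P.intercept p.1) / (P.slope p.1 - P.slope p.2))) ?_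
  intro t ht
  simp only [NoTie, Set.InjOn, Set.mem_ofPred_eq, not_forall] at ht
  obtain ⟨e, he, f, hf, hef, hne⟩ := ht
  refine ⟨(e, f), ?_⟩
  have h1 : P.slope e - P.slope f ≠ 0 := by
    intro h
    apply hne
    apply h₀ he hf
    simp only [weightAt] at hef ⊢
    have : P.slope e = P.slope f := by linarith
    rw [this] at hef ⊢
    linarith
  simp only [weightAt] at hef
  rw [div_eq_iff h1]
  linarith

lemma ncard_edgeSet_treeAt {a b : ℝ} (ha : P.NoTie a) (hb : P.NoTie b) :
    (P.treeAt a).edgeSet.ncard = (P.treeAt b).edgeSet.ncard := by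
  have h1 := (SimpleGraph.isTree_iff_connected_and_card.1 ha.isUniqueMin.1.2).2
  have h2 := (SimpleGraph.isTree_iff_connected_and_card.1 hb.isUniqueMin.1.2).2
  rw [Nat.card_coe_set_eq] at h1 h2
  omega

/-- If at most one pair of edges changes its order, at most one edge leaves the tree. -/
lemma ncard_diff_le_one {a b : ℝ} (hP : P.Generic) (ha : P.NoTie a) (hb : P.NoTie b)
    (hab : a ≤ b) (hsub : ∀ s t, a < s → s < b → a < t → t < b → ¬ P.NoTie s → ¬ P.NoTie t → s = t) :
    ((P.treeAt a).edgeSet \ (P.treeAt b).edgeSet).ncard ≤ 1 := by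
  classical
  by_contra! hcon
  obtain ⟨e, he, f, hf, hef⟩ := (Set.one_lt_ncard (Set.toFinite _)).1 hcon
  have hle : ∀ t, (P.treeAt t).edgeSet ⊆ P.graph.edgeSet := fun t =>
    SimpleGraph.edgeSet_subset_edgeSet.2 (kruskalTree_le _ _)
  -- An edge that changes its status is part of a pair that changes its order.
  have key : ∀ g ∈ P.graph.edgeSet, (∀ s, a < s → s < b → ∀ h ∈ P.graph.edgeSet, h ≠ g →
      P.weightAt s g ≠ P.weightAt s h) → (g ∈ (P.treeAt a).edgeSet ↔ g ∈ (P.treeAt b).edgeSet) := by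
    intro g hg hno
    have hcomp : ∀ h ∈ P.graph.edgeSet,
        P.weightAt a h < P.weightAt a g ↔ P.weightAt b h < P.weightAt b g := by
      intro h hh
      by_cases hhg : h = g
      · subst hhg; simp
      constructor
      · intro h1
        by_contra! h2
        have h3 := lt_of_le_of_ne h2 (fun h => hhg (hb hg hh h).symm)
        obtain ⟨t, ht1, ht2, ht3⟩ := exists_tie_between hab h1 h3
        exact hno t ht1 ht2 h hh hhg ht3.symm
      · intro h1
        by_contra! h2
        have h3 := lt_of_le_of_ne h2 (fun h => hhg (ha hg hh h).symm)
        obtain ⟨t, ht1, ht2, ht3⟩ := exists_tie_between hab h3 h1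
        exact hno t ht1 ht2 h hh hhg ht3
    exact ⟨mem_kruskalTree_congr hcomp, mem_kruskalTree_congr (fun h hh => (hcomp h hh).symm)⟩
  have tie : ∀ g ∈ P.graph.edgeSet, ¬ (g ∈ (P.treeAt a).edgeSet ↔ g ∈ (P.treeAt b).edgeSet) →
      ∃ s, a < s ∧ s < b ∧ ∃ h ∈ P.graph.edgeSet, h ≠ g ∧ P.weightAt s g = P.weightAt s h := by
    intro g hg hn
    by_contra! hcon
    exact hn (key g hg (fun s h1 h2 h hh hne => hcon s h1 h2 h hh hne))
  have notie : ∀ s g h, g ∈ P.graph.edgeSet → h ∈ P.graph.edgeSet → h ≠ g →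
      P.weightAt s g = P.weightAt s h → ¬ P.NoTie s :=
    fun s g h hg hh hne heq hs => hne (hs hg hh heq).symm
  obtain ⟨s, hs1, hs2, h, hh, hhe, hse⟩ := tie e (hle _ he.1) (by have := he.1; have := he.2; tauto)
  obtain ⟨s', hs1', hs2', h', hh', hhf, hsf⟩ :=
    tie f (hle _ hf.1) (by have := hf.1; have := hf.2; tauto)
  obtain rfl : s = s' := hsub s s' hs1 hs2 hs1' hs2' (notie s e h (hle _ he.1) hh hhe hse)
    (notie s' f h' (hle _ hf.1) hh' hhf hsf)
  have hsame : h = f := by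
    rcases hP s e (hle _ he.1) h hh f (hle _ hf.1) h' hh' hhe.symm hhf.symm hse hsf with h1 | h1
    · exact absurd h1.1 hef
    · exact h1.2
  subst hsame
  -- Both edges leave the tree, so another edge enters it, and is part of a further pair.
  have hcard : ((P.treeAt b).edgeSet \ (P.treeAt a).edgeSet).Nonempty := by
    rw [Set.nonempty_iff_ne_empty, Ne, Set.sdiff_eq_empty]
    intro hsubset
    have := Set.eq_of_subset_of_ncard_le hsubset (ncard_edgeSet_treeAt ha hb).le (Set.toFinite _)
    exact he.2 (this ▸ he.1)
  obtain ⟨g, hg⟩ := hcard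
  obtain ⟨s', hs1', hs2', h', hh', hhg, hsg⟩ :=
    tie g (hle _ hg.1) (by have := hg.1; have := hg.2; tauto)
  obtain rfl : s = s' := hsub s s' hs1 hs2 hs1' hs2' (notie s e h (hle _ he.1) hh hhe hse)
    (notie s' g h' (hle _ hg.1) hh' hhg hsg)
  rcases hP s e (hle _ he.1) h hh g (hle _ hg.1) h' hh' hhe.symm hhg.symm hse hsg with h1 | h1
  · exact hg.2 (h1.1 ▸ he.1)
  · exact hg.2 (h1.2 ▸ hf.1)

/-- In a generic instance edges leave the tree one at a time, so that two trees that differ by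
many edges have many trees between them. -/
lemma ncard_diff_lt_ncard_treesOn (hP : P.Generic) {a b : ℝ} (ha : P.NoTie a) (hb : P.NoTie b)
    (hab : a ≤ b) :
    ((P.treeAt a).edgeSet \ (P.treeAt b).edgeSet).ncard + 1 ≤ (P.treesOn a b).ncard := by
  classical
  have hfin := finite_tie ha
  induction hn : ({t | ¬ P.NoTie t} ∩ Set.Ioo a b).ncard using Nat.strong_induction_on
    generalizing a b with
  | _ n ih =>
    by_cases hsub : ∀ s t, a < s → s < b → a < t → t < b → ¬ P.NoTie s → ¬ P.NoTie t → s = t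
    · have h1 := ncard_diff_le_one hP ha hb hab hsub
      rcases Nat.le_one_iff_eq_zero_or_eq_one.1 h1 with h0 | h0
      · rw [h0, zero_add, Nat.succ_le_iff, Set.ncard_pos (Set.toFinite _)]
        exact ⟨_, treeAt_mem_treesOn ha le_rfl hab⟩
      · rw [h0, Nat.succ_le_iff, Set.one_lt_ncard (Set.toFinite _)]
        refine ⟨_, treeAt_mem_treesOn ha le_rfl hab, _, treeAt_mem_treesOn hb hab le_rfl, ?_⟩
        intro heq
        rw [heq] at h0
        simp at h0
    · push Not at hsub
      obtain ⟨s, t, hs1, hs2, ht1, ht2, hs, ht, hst⟩ := hsub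
      wlog hlt : s < t generalizing s t
      · exact this t s ht1 ht2 hs1 hs2 ht hs hst.symm (lt_of_le_of_ne (not_lt.1 hlt) hst.symm)
      obtain ⟨c, ⟨hc1, hc2⟩, hc⟩ := ((Set.Ioo_infinite hlt).sdiff hfin).nonempty
      have hc' : P.NoTie c := not_not.1 hc
      have hac : a ≤ c := (hs1.trans hc1).le
      have hcb : c ≤ b := (hc2.trans ht2).le
      have l1 : ({t | ¬ P.NoTie t} ∩ Set.Ioo a c).ncard < n := by
        rw [← hn]
        refine Set.ncard_lt_ncard ⟨fun x hx => ⟨hx.1, hx.2.1, hx.2.2.trans_le hcb⟩, fun h => ?_⟩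
          (hfin.inter_of_left _)
        exact absurd (h ⟨ht, ht1, ht2⟩).2.2 (not_lt.2 hc2.le)
      have l2 : ({t | ¬ P.NoTie t} ∩ Set.Ioo c b).ncard < n := by
        rw [← hn]
        refine Set.ncard_lt_ncard ⟨fun x hx => ⟨hx.1, hac.trans_lt hx.2.1, hx.2.2⟩, fun h => ?_⟩
          (hfin.inter_of_left _)
        exact absurd (h ⟨hs, hs1, hs2⟩).2.1 (not_lt.2 hc1.le)
      have i1 := ih _ l1 ha hc' hac rfl
      have i2 := ih _ l2 hc' hb hcb rfl
      have i3 := ncard_treesOn_add_le (P := P) hc' hac hcb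
      have i4 : ((P.treeAt a).edgeSet \ (P.treeAt b).edgeSet).ncard ≤
          ((P.treeAt a).edgeSet \ (P.treeAt c).edgeSet).ncard +
          ((P.treeAt c).edgeSet \ (P.treeAt b).edgeSet).ncard := by
        refine le_trans (Set.ncard_le_ncard ?_ (Set.toFinite _)) (Set.ncard_union_le _ _)
        intro x hx
        by_cases hxc : x ∈ (P.treeAt c).edgeSet
        · exact Or.inr ⟨hxc, hx.2⟩
        · exact Or.inl ⟨hx.1, hxc⟩
      omega

/-- The number of minimum spanning trees of a generic instance is at least one more than the
number of edges that leave the tree between consecutive sample values of the parameter. -/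
theorem sum_ncard_diff_lt_ncard_minSpanningTrees (hP : P.Generic) (τ : ℕ → ℝ) (N : ℕ)
    (hτ : ∀ i ≤ N, P.NoTie (τ i)) (hmono : ∀ i < N, τ i ≤ τ (i + 1)) :
    ∑ i ∈ Finset.range N, ((P.treeAt (τ i)).edgeSet \ (P.treeAt (τ (i + 1))).edgeSet).ncard + 1 ≤
      P.minSpanningTrees.ncard := by
  classical
  refine le_trans ?_ (Set.ncard_le_ncard (treesOn_subset (τ 0) (τ N)) (Set.toFinite _))
  suffices h : τ 0 ≤ τ N ∧ ∑ i ∈ Finset.range N,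
      ((P.treeAt (τ i)).edgeSet \ (P.treeAt (τ (i + 1))).edgeSet).ncard + 1 ≤
      (P.treesOn (τ 0) (τ N)).ncard from h.2
  induction N with
  | zero =>
    refine ⟨le_rfl, ?_⟩
    rw [Finset.sum_range_zero, zero_add, Nat.succ_le_iff, Set.ncard_pos (Set.toFinite _)]
    exact ⟨_, treeAt_mem_treesOn (hτ 0 le_rfl) le_rfl le_rfl⟩
  | succ N ih =>
    obtain ⟨h0, h1⟩ := ih (fun i hi => hτ i (by omega)) (fun i hi => hmono i (by omega))
    have h2 := hmono N (by omega)
    refine ⟨h0.trans h2, ?_⟩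
    rw [Finset.sum_range_succ]
    have h3 := ncard_treesOn_add_le (P := P) (hτ N (by omega)) h0 h2
    have h4 := ncard_diff_lt_ncard_treesOn hP (hτ N (by omega)) (hτ (N + 1) le_rfl) h2
    omega

end ParametricGraph

/-! ### Generic perturbations -/

/-- The intercepts of finitely many lines can be perturbed so that at most two of them meet at any
parameter value, and none at the given values. -/
lemma exists_generic_intercepts {E : Type*} (F : Finset E) (a b₀ : E → ℝ) (Λ : Finset ℝ)
    (hΛ : Λ.Nonempty) {ε : ℝ} (hε : 0 < ε) :
    ∃ b : E → ℝ, (∀ e, |b e - b₀ e| < ε) ∧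
      (∀ t ∈ Λ, Set.InjOn (fun e => a e * t + b e) F) ∧
      ∀ t : ℝ, ∀ e ∈ F, ∀ f ∈ F, ∀ g ∈ F, ∀ h ∈ F, e ≠ f → g ≠ h →
        a e * t + b e = a f * t + b f → a g * t + b g = a h * t + b h →
        (e = g ∧ f = h) ∨ (e = h ∧ f = g) := by
  classical
  induction F using Finset.induction_on with
  | empty => exact ⟨b₀, by simpa using fun _ => hε, by simp, by simp⟩
  | insert e F he ih =>
    obtain ⟨b, hb, hinj, hgen⟩ := ih
    -- The line of `e` has to avoid all other lines at these values of the parameter.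
    set X : Finset ℝ := Λ ∪ (F ×ˢ F).image (fun p => (b p.2 - b p.1) / (a p.1 - a p.2)) with hX
    set Bad : Finset ℝ := (F ×ˢ X).image (fun p => a p.1 * p.2 + b p.1 - a e * p.2) with hBad
    obtain ⟨y, ⟨hy1, hy2⟩, hyB⟩ :=
      ((Set.Ioo_infinite (show b₀ e - ε < b₀ e + ε by linarith)).sdiff Bad.finite_toSet).nonempty
    have hne : ∀ f ∈ F, ∀ t ∈ X, a e * t + y ≠ a f * t + b f := by
      intro f hf t ht heq
      exact hyB (Finset.mem_coe.2 (Finset.mem_image.2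
        ⟨(f, t), Finset.mem_product.2 ⟨hf, ht⟩, by simp only; linarith⟩))
    obtain ⟨t₀, ht₀⟩ := hΛ
    have hcross : ∀ f ∈ F, ∀ g ∈ F, f ≠ g → ∀ t, a f * t + b f = a g * t + b g → t ∈ X := by
      intro f hf g hg hfg t ht
      have h1 : a f - a g ≠ 0 := by
        intro h
        apply hfg
        apply hinj t₀ ht₀ hf hg
        have : a f = a g := by linarith
        simp only [this] at ht ⊢
        linarith
      refine Finset.mem_union_right _ (Finset.mem_image.2 ⟨(f, g), by simp [hf, hg], ?_⟩)
      simp only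
      rw [div_eq_iff h1]
      linarith
    have hupd : ∀ f ∈ F, Function.update b e y f = b f := fun f hf =>
      Function.update_of_ne (by rintro rfl; exact he hf) _ _
    have hsep : ∀ f ∈ F, ∀ g ∈ F, ∀ h ∈ F, ∀ t, g ≠ h → a e * t + y = a f * t + b f →
        a g * t + b g ≠ a h * t + b h :=
      fun f hf g hg h hh t hgh h1 h2 => hne f hf t (hcross g hg h hh hgh t h2) h1
    refine ⟨Function.update b e y, ?_, ?_, ?_⟩
    · intro f
      by_cases hf : f = e
      · subst hf
        simp only [Function.update_self, abs_lt]
        constructor <;> linarith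
      · simpa [Function.update_of_ne hf] using hb f
    · intro t ht f hf g hg hfg
      have htX : t ∈ X := Finset.mem_union_left _ ht
      rcases Finset.mem_insert.1 hf with rfl | hf' <;> rcases Finset.mem_insert.1 hg with rfl | hg'
      · rfl
      · simp only [Function.update_self, hupd _ hg'] at hfg
        exact absurd hfg (hne g hg' t htX)
      · simp only [Function.update_self, hupd _ hf'] at hfg
        exact absurd hfg.symm (hne f hf' t htX)
      · simp only [hupd _ hf', hupd _ hg'] at hfg
        exact hinj t ht hf' hg' hfg
    · -- Two different ties that both involve `e` give a tie of two other lines.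
      have two : ∀ t, ∀ f ∈ F, ∀ g ∈ F, a e * t + y = a f * t + b f →
          a e * t + y = a g * t + b g → f = g := by
        intro t f hf g hg h1 h2
        by_contra hfg
        exact hsep f hf f hf g hg t hfg h1 (h1.symm.trans h2)
      intro t f hf g hg h hh k hk hfg hhk h1 h2
      rcases Finset.mem_insert.1 hf with rfl | hf' <;> rcases Finset.mem_insert.1 hg with rfl | hg' <;>
      rcases Finset.mem_insert.1 hh with rfl | hh' <;> rcases Finset.mem_insert.1 hk with rfl | hk' <;>
      simp only [Function.update_self, *] at h1 h2
      all_goals first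
        | exact absurd rfl hfg
        | exact absurd rfl hhk
        | exact Or.inl ⟨rfl, two t _ hg' _ hk' h1 h2⟩
        | exact Or.inr ⟨rfl, two t _ hg' _ hh' h1 h2.symm⟩
        | exact Or.inr ⟨two t _ hf' _ hk' h1.symm h2, rfl⟩
        | exact Or.inl ⟨two t _ hf' _ hh' h1.symm h2.symm, rfl⟩
        | exact absurd h2 (hsep _ hg' _ hh' _ hk' t hhk h1)
        | exact absurd h2 (hsep _ hf' _ hh' _ hk' t hhk h1.symm)
        | exact absurd h1 (hsep _ hk' _ hf' _ hg' t hfg h2)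
        | exact absurd h1 (hsep _ hh' _ hf' _ hg' t hfg h2.symm)
        | exact hgen t _ hf' _ hg' _ hh' _ hk' hfg hhk h1 h2

/-! ### The alternating series-parallel network -/

section Network

/-- `OutTree i t x`: edge `x` of the network of depth `i` belongs, at time `t`, to the minimum
spanning forest with two components that separates the two terminals. Edges and times are numbered by `0, …, 2 ^ i - 1`; the
bottleneck edge between the terminals at time `t` is `t` itself. The network of depth `i + 1`
consists of two copies of the network of depth `i`, in series if `i` is even and in parallel
otherwise; edge `2 * q + b` is edge `q` of copy `b`. -/
def OutTree : ℕ → ℕ → ℕ → Prop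
  | 0, _, _ => False
  | i + 1, t, x => OutTree i (t / 2) (x / 2) ∨ (Even i ∧ x / 2 = t / 2 ∧ x ≠ t)

/-- Edge `x` of the network of depth `i` belongs to the minimum spanning tree at time `t`. -/
def InTree (i t x : ℕ) : Prop := OutTree i t x ∨ x = t

/-- The other edge of the pair `2 * q`, `2 * q + 1` that contains edge `t`. -/
def twin (t : ℕ) : ℕ := 2 * (t / 2) + (1 - t % 2)

/-- The edge weights `u` order the bottleneck edges of the two halves of each subnetwork in the
way that makes `t` the bottleneck edge: in a series connection the heavier of the two is the
bottleneck, in a parallel connection the lighter. -/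
def BottleneckOrder : ℕ → (ℕ → ℝ) → ℕ → Prop
  | 0, _, _ => True
  | i + 1, u, t => (∀ b < 2, BottleneckOrder i (fun q => u (2 * q + b)) (t / 2)) ∧
      if Even i then u (twin t) < u t else u t < u (twin t)

/-- The endpoints of edge `q` in the network of depth `i` with terminals `s` and `t`. A series
connection has an inner vertex; the inner vertices are the values of `μ`, indexed by the path from
the root of the construction. The edges are directed from `s` to `t`. -/
def ends {V : Type*} : ℕ → (List Bool → V) → V → V → ℕ → V × V
  | 0, _, s, t, _ => (s, t)
  | i + 1, μ, s, t, q =>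
    if Even i then
      if q % 2 = 0 then ends i (fun l => μ (false :: l)) s (μ []) (q / 2)
      else ends i (fun l => μ (true :: l)) (μ []) t (q / 2)
    else ends i (fun l => μ (decide (q % 2 = 1) :: l)) s t (q / 2)

lemma map_ends {V W : Type*} (f : V → W) (i : ℕ) (μ : List Bool → V) (s t : V) (q : ℕ) :
    Prod.map f f (ends i μ s t q) = ends i (f ∘ μ) (f s) (f t) q := by
  induction i generalizing μ s t q with
  | zero => rfl
  | succ i ih =>
    simp only [ends]
    split_ifs <;> rw [ih] <;> rfl

lemma twin_lt {t i : ℕ} (h : t < 2 ^ (i + 1)) : twin t < 2 ^ (i + 1) := by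
  rw [pow_succ] at *; unfold twin; omega

/-- The colouring given by `χ`, `cs` and `ct` does not separate the endpoints of any edge of
weight less than `θ`. -/
def ConstBelow (i : ℕ) (u : ℕ → ℝ) (θ : ℝ) (χ : List Bool → Bool) (cs ct : Bool) : Prop :=
  ∀ q < 2 ^ i, u q < θ → (ends i χ cs ct q).1 = (ends i χ cs ct q).2

lemma ends_const (i : ℕ) (c : Bool) (q : ℕ) : ends i (fun _ => c) c c q = (c, c) := by
  induction i generalizing q with
  | zero => rfl
  | succ i ih => simp only [ends]; split_ifs <;> exact ih _

lemma constBelow_const (i : ℕ) (u : ℕ → ℝ) (θ : ℝ) (c : Bool) :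
    ConstBelow i u θ (fun _ => c) c c := fun q _ _ => by rw [ends_const]

lemma ConstBelow.mono {i : ℕ} {u : ℕ → ℝ} {θ θ' : ℝ} {χ : List Bool → Bool} {cs ct : Bool}
    (h : ConstBelow i u θ χ cs ct) (hθ : θ' ≤ θ) : ConstBelow i u θ' χ cs ct :=
  fun q hq hu => h q hq (hu.trans_le hθ)

/-- The colouring of a composite network with the given colourings of its two halves, and the
given colour of the inner vertex. -/
def glue (c : Bool) (χ₀ χ₁ : List Bool → Bool) : List Bool → Bool
  | [] => c
  | false :: l => χ₀ l
  | true :: l => χ₁ l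

lemma ends_series {V : Type*} {i : ℕ} (hi : Even i) (μ : List Bool → V) (s t : V) (q : ℕ) :
    ends (i + 1) μ s t (2 * q) = ends i (fun l => μ (false :: l)) s (μ []) q ∧
    ends (i + 1) μ s t (2 * q + 1) = ends i (fun l => μ (true :: l)) (μ []) t q := by
  have h1 : (2 * q + 1) / 2 = q := by omega
  have h2 : (2 * q + 1) % 2 = 1 := by omega
  simp [ends, hi, h1, h2]

lemma ends_parallel {V : Type*} {i : ℕ} (hi : ¬ Even i) (μ : List Bool → V) (s t : V) (q : ℕ) :
    ends (i + 1) μ s t (2 * q) = ends i (fun l => μ (false :: l)) s t q ∧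
    ends (i + 1) μ s t (2 * q + 1) = ends i (fun l => μ (true :: l)) s t q := by
  have h1 : (2 * q + 1) / 2 = q := by omega
  have h2 : (2 * q + 1) % 2 = 1 := by omega
  simp [ends, hi, h1, h2]

lemma constBelow_series {i : ℕ} (hi : Even i) {u : ℕ → ℝ} {θ : ℝ} {χ : List Bool → Bool}
    {cs ct : Bool} : ConstBelow (i + 1) u θ χ cs ct ↔
      ConstBelow i (fun q => u (2 * q)) θ (fun l => χ (false :: l)) cs (χ []) ∧
      ConstBelow i (fun q => u (2 * q + 1)) θ (fun l => χ (true :: l)) (χ []) ct := by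
  have hp : 2 ^ (i + 1) = 2 * 2 ^ i := by ring
  refine ⟨fun h => ⟨fun q hq hu => ?_, fun q hq hu => ?_⟩, fun h q hq hu => ?_⟩
  · rw [← (ends_series hi χ cs ct q).1]; exact h _ (by omega) hu
  · rw [← (ends_series hi χ cs ct q).2]; exact h _ (by omega) hu
  · obtain ⟨k, rfl | rfl⟩ : ∃ k, q = 2 * k ∨ q = 2 * k + 1 := ⟨q / 2, by omega⟩
    · rw [(ends_series hi χ cs ct k).1]; exact h.1 k (by omega) hu
    · rw [(ends_series hi χ cs ct k).2]; exact h.2 k (by omega) hu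

lemma constBelow_parallel {i : ℕ} (hi : ¬ Even i) {u : ℕ → ℝ} {θ : ℝ} {χ : List Bool → Bool}
    {cs ct : Bool} : ConstBelow (i + 1) u θ χ cs ct ↔
      ConstBelow i (fun q => u (2 * q)) θ (fun l => χ (false :: l)) cs ct ∧
      ConstBelow i (fun q => u (2 * q + 1)) θ (fun l => χ (true :: l)) cs ct := by
  have hp : 2 ^ (i + 1) = 2 * 2 ^ i := by ring
  refine ⟨fun h => ⟨fun q hq hu => ?_, fun q hq hu => ?_⟩, fun h q hq hu => ?_⟩
  · rw [← (ends_parallel hi χ cs ct q).1]; exact h _ (by omega) hu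
  · rw [← (ends_parallel hi χ cs ct q).2]; exact h _ (by omega) hu
  · obtain ⟨k, rfl | rfl⟩ : ∃ k, q = 2 * k ∨ q = 2 * k + 1 := ⟨q / 2, by omega⟩
    · rw [(ends_parallel hi χ cs ct k).1]; exact h.1 k (by omega) hu
    · rw [(ends_parallel hi χ cs ct k).2]; exact h.2 k (by omega) hu

lemma twin_two_mul (k : ℕ) : twin (2 * k) = 2 * k + 1 := by unfold twin; omega
lemma twin_two_mul_add_one (k : ℕ) : twin (2 * k + 1) = 2 * k := by unfold twin; omega

lemma BottleneckOrder.halves {i : ℕ} {u : ℕ → ℝ} {t k : ℕ} (h : BottleneckOrder (i + 1) u t)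
    (hk : t / 2 = k) : BottleneckOrder i (fun q => u (2 * q)) k ∧
      BottleneckOrder i (fun q => u (2 * q + 1)) k :=
  hk ▸ ⟨h.1 0 (by norm_num), h.1 1 (by norm_num)⟩

/-- At the threshold given by the weight of the bottleneck edge, lighter edges connect its
endpoints to the two terminals. -/
lemma ends_bottleneck {i : ℕ} {u : ℕ → ℝ} {t : ℕ} (ht : t < 2 ^ i) (hu : BottleneckOrder i u t)
    {χ : List Bool → Bool} {cs ct : Bool} (h : ConstBelow i u (u t) χ cs ct) :
    ends i χ cs ct t = (cs, ct) := by
  induction i generalizing u t χ cs ct with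
  | zero => rfl
  | succ i ih =>
    rw [pow_succ] at ht
    have hcmp := hu.2
    by_cases hi : Even i
    · rw [if_pos hi] at hcmp
      rw [constBelow_series hi] at h
      obtain ⟨k, rfl | rfl⟩ : ∃ k, t = 2 * k ∨ t = 2 * k + 1 := ⟨t / 2, by omega⟩
      · rw [twin_two_mul] at hcmp
        obtain ⟨h0, h1⟩ := hu.halves (k := k) (by omega)
        have e1 := h.2 k (by omega) hcmp
        rw [ih (by omega) h1 (h.2.mono hcmp.le)] at e1
        rw [(ends_series hi _ _ _ k).1, ih (by omega) h0 h.1]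
        exact Prod.ext rfl e1
      · rw [twin_two_mul_add_one] at hcmp
        obtain ⟨h0, h1⟩ := hu.halves (k := k) (by omega)
        have e1 := h.1 k (by omega) hcmp
        rw [ih (by omega) h0 (h.1.mono hcmp.le)] at e1
        rw [(ends_series hi _ _ _ k).2, ih (by omega) h1 h.2]
        exact Prod.ext e1.symm rfl
    · rw [constBelow_parallel hi] at h
      obtain ⟨k, rfl | rfl⟩ : ∃ k, t = 2 * k ∨ t = 2 * k + 1 := ⟨t / 2, by omega⟩
      · obtain ⟨h0, h1⟩ := hu.halves (k := k) (by omega)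
        rw [(ends_parallel hi _ _ _ k).1, ih (by omega) h0 h.1]
      · obtain ⟨h0, h1⟩ := hu.halves (k := k) (by omega)
        rw [(ends_parallel hi _ _ _ k).2, ih (by omega) h1 h.2]

/-- Edges lighter than the bottleneck edge do not connect the terminals. -/
lemma exists_constBelow_bottleneck {i : ℕ} {u : ℕ → ℝ} {t : ℕ} (ht : t < 2 ^ i)
    (hu : BottleneckOrder i u t) (cs ct : Bool) : ∃ χ, ConstBelow i u (u t) χ cs ct := by
  induction i generalizing u t cs ct with
  | zero =>
    refine ⟨fun _ => cs, fun q hq hlt => ?_⟩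
    have h1 : q = t := by simp at ht hq; omega
    exact absurd hlt (by rw [h1]; exact lt_irrefl _)
  | succ i ih =>
    rw [pow_succ] at ht
    have hcmp := hu.2
    obtain ⟨h0, h1⟩ := hu.halves rfl
    by_cases hi : Even i
    · obtain ⟨k, rfl | rfl⟩ : ∃ k, t = 2 * k ∨ t = 2 * k + 1 := ⟨t / 2, by omega⟩
      · rw [show 2 * k / 2 = k by omega] at h0 h1
        obtain ⟨χ, hχ⟩ := ih (by omega) h0 cs ct
        exact ⟨glue ct χ (fun _ => ct), (constBelow_series hi).2 ⟨hχ, constBelow_const _ _ _ _⟩⟩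
      · rw [show (2 * k + 1) / 2 = k by omega] at h0 h1
        obtain ⟨χ, hχ⟩ := ih (by omega) h1 cs ct
        exact ⟨glue cs (fun _ => cs) χ, (constBelow_series hi).2 ⟨constBelow_const _ _ _ _, hχ⟩⟩
    · rw [if_neg hi] at hcmp
      obtain ⟨χ₀, hχ₀⟩ := ih (by omega) h0 cs ct
      obtain ⟨χ₁, hχ₁⟩ := ih (by omega) h1 cs ct
      refine ⟨glue cs χ₀ χ₁, (constBelow_parallel hi).2 ?_⟩
      obtain ⟨k, rfl | rfl⟩ : ∃ k, t = 2 * k ∨ t = 2 * k + 1 := ⟨t / 2, by omega⟩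
      · rw [twin_two_mul] at hcmp
        rw [show 2 * k / 2 = k by omega] at hχ₀ hχ₁
        exact ⟨hχ₀, hχ₁.mono hcmp.le⟩
      · rw [twin_two_mul_add_one] at hcmp
        rw [show (2 * k + 1) / 2 = k by omega] at hχ₀ hχ₁
        exact ⟨hχ₀.mono hcmp.le, hχ₁⟩

lemma outTree_self (i t : ℕ) : ¬ OutTree i t t := by
  induction i generalizing t with
  | zero => exact id
  | succ i ih => rintro (h | h); exacts [ih _ h, h.2.2 rfl]

/-- Lighter edges connect the endpoints of an edge outside the tree. -/
lemma ends_eq_of_not_inTree {i : ℕ} {u : ℕ → ℝ} {t x : ℕ} (ht : t < 2 ^ i) (hx : x < 2 ^ i)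
    (hu : BottleneckOrder i u t) (hxt : ¬ InTree i t x) {χ : List Bool → Bool} {cs ct : Bool}
    (h : ConstBelow i u (u x) χ cs ct) : (ends i χ cs ct x).1 = (ends i χ cs ct x).2 := by
  induction i generalizing u t x χ cs ct with
  | zero => exact absurd (Or.inr (by simp at ht hx; omega)) hxt
  | succ i ih =>
    rw [pow_succ] at ht hx
    have hcmp := hu.2
    have hx1 : ¬ OutTree i (t / 2) (x / 2) := fun h => hxt (Or.inl (Or.inl h))
    have hx2 : x ≠ t := fun h => hxt (Or.inr h)
    obtain ⟨h0, h1⟩ := hu.halves rfl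
    by_cases hi : Even i
    · have hx3 : ¬ InTree i (t / 2) (x / 2) := by
        rintro (h | h)
        exacts [hx1 h, hxt (Or.inl (Or.inr ⟨hi, h, hx2⟩))]
      rw [constBelow_series hi] at h
      obtain ⟨k, rfl | rfl⟩ : ∃ k, x = 2 * k ∨ x = 2 * k + 1 := ⟨x / 2, by omega⟩
      · rw [show 2 * k / 2 = k by omega] at hx3
        rw [(ends_series hi _ _ _ k).1]
        exact ih (by omega) (by omega) h0 hx3 h.1
      · rw [show (2 * k + 1) / 2 = k by omega] at hx3
        rw [(ends_series hi _ _ _ k).2]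
        exact ih (by omega) (by omega) h1 hx3 h.2
    · rw [if_neg hi] at hcmp
      rw [constBelow_parallel hi] at h
      by_cases hxk : x / 2 = t / 2
      · -- Here `x` is the twin of `t`: the half containing `t` connects the terminals.
        obtain ⟨k, rfl | rfl⟩ : ∃ k, t = 2 * k ∨ t = 2 * k + 1 := ⟨t / 2, by omega⟩
        · obtain rfl : x = 2 * k + 1 := by omega
          rw [twin_two_mul] at hcmp
          rw [show 2 * k / 2 = k by omega] at h0 h1
          have e1 := h.1 k (by omega) hcmp
          rw [ends_bottleneck (by omega) h0 (h.1.mono hcmp.le)] at e1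
          rw [(ends_parallel hi _ _ _ k).2, ends_bottleneck (by omega) h1 h.2]
          exact e1
        · obtain rfl : x = 2 * k := by omega
          rw [twin_two_mul_add_one] at hcmp
          rw [show (2 * k + 1) / 2 = k by omega] at h0 h1
          have e1 := h.2 k (by omega) hcmp
          rw [ends_bottleneck (by omega) h1 (h.2.mono hcmp.le)] at e1
          rw [(ends_parallel hi _ _ _ k).1, ends_bottleneck (by omega) h0 h.1]
          exact e1
      · have hx3 : ¬ InTree i (t / 2) (x / 2) := by
          rintro (h | h)
          exacts [hx1 h, hxk h]
        obtain ⟨k, rfl | rfl⟩ : ∃ k, x = 2 * k ∨ x = 2 * k + 1 := ⟨x / 2, by omega⟩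
        · rw [show 2 * k / 2 = k by omega] at hx3
          rw [(ends_parallel hi _ _ _ k).1]
          exact ih (by omega) (by omega) h0 hx3 h.1
        · rw [show (2 * k + 1) / 2 = k by omega] at hx3
          rw [(ends_parallel hi _ _ _ k).2]
          exact ih (by omega) (by omega) h1 hx3 h.2

/-- Even if the terminals are identified, lighter edges do not connect the endpoints of an edge of
the separating forest. -/
lemma exists_constBelow_of_outTree {i : ℕ} {u : ℕ → ℝ} {t x : ℕ} (ht : t < 2 ^ i) (hx : x < 2 ^ i)
    (hu : BottleneckOrder i u t) (hxt : OutTree i t x) (c : Bool) :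
    ∃ χ, ConstBelow i u (u x) χ c c ∧ (ends i χ c c x).1 ≠ (ends i χ c c x).2 := by
  induction i generalizing u t x c with
  | zero => exact absurd hxt id
  | succ i ih =>
    rw [pow_succ] at ht hx
    have hcmp := hu.2
    obtain ⟨h0, h1⟩ := hu.halves rfl
    rcases hxt with hxt | ⟨hi, hxk, hne⟩
    · by_cases hi : Even i
      · obtain ⟨k, rfl | rfl⟩ : ∃ k, x = 2 * k ∨ x = 2 * k + 1 := ⟨x / 2, by omega⟩
        · rw [show 2 * k / 2 = k by omega] at hxt
          obtain ⟨χ, hχ, hd⟩ := ih (by omega) (by omega) h0 hxt c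
          refine ⟨glue c χ (fun _ => c), (constBelow_series hi).2 ⟨hχ, constBelow_const _ _ _ _⟩, ?_⟩
          rw [(ends_series hi _ _ _ k).1]; exact hd
        · rw [show (2 * k + 1) / 2 = k by omega] at hxt
          obtain ⟨χ, hχ, hd⟩ := ih (by omega) (by omega) h1 hxt c
          refine ⟨glue c (fun _ => c) χ, (constBelow_series hi).2 ⟨constBelow_const _ _ _ _, hχ⟩, ?_⟩
          rw [(ends_series hi _ _ _ k).2]; exact hd
      · obtain ⟨k, rfl | rfl⟩ : ∃ k, x = 2 * k ∨ x = 2 * k + 1 := ⟨x / 2, by omega⟩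
        · rw [show 2 * k / 2 = k by omega] at hxt
          obtain ⟨χ, hχ, hd⟩ := ih (by omega) (by omega) h0 hxt c
          refine ⟨glue c χ (fun _ => c), (constBelow_parallel hi).2 ⟨hχ, constBelow_const _ _ _ _⟩, ?_⟩
          rw [(ends_parallel hi _ _ _ k).1]; exact hd
        · rw [show (2 * k + 1) / 2 = k by omega] at hxt
          obtain ⟨χ, hχ, hd⟩ := ih (by omega) (by omega) h1 hxt c
          refine ⟨glue c (fun _ => c) χ, (constBelow_parallel hi).2 ⟨constBelow_const _ _ _ _, hχ⟩, ?_⟩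
          rw [(ends_parallel hi _ _ _ k).2]; exact hd
    · -- Here `x` is the twin of `t`, the lighter of the two bottleneck edges in series.
      rw [if_pos hi] at hcmp
      have hcn : c ≠ !c := by cases c <;> simp
      obtain ⟨k, rfl | rfl⟩ : ∃ k, t = 2 * k ∨ t = 2 * k + 1 := ⟨t / 2, by omega⟩
      · obtain rfl : x = 2 * k + 1 := by omega
        rw [twin_two_mul] at hcmp
        rw [show 2 * k / 2 = k by omega] at h0 h1
        obtain ⟨χ₀, hχ₀⟩ := exists_constBelow_bottleneck (by omega) h0 c (!c)
        obtain ⟨χ₁, hχ₁⟩ := exists_constBelow_bottleneck (by omega) h1 (!c) c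
        refine ⟨glue (!c) χ₀ χ₁, (constBelow_series hi).2 ⟨hχ₀.mono hcmp.le, hχ₁⟩, ?_⟩
        rw [(ends_series hi _ _ _ k).2]
        change (ends i χ₁ (!c) c k).1 ≠ (ends i χ₁ (!c) c k).2
        rw [ends_bottleneck (by omega) h1 hχ₁]
        exact hcn.symm
      · obtain rfl : x = 2 * k := by omega
        rw [twin_two_mul_add_one] at hcmp
        rw [show (2 * k + 1) / 2 = k by omega] at h0 h1
        obtain ⟨χ₀, hχ₀⟩ := exists_constBelow_bottleneck (by omega) h0 c (!c)
        obtain ⟨χ₁, hχ₁⟩ := exists_constBelow_bottleneck (by omega) h1 (!c) c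
        refine ⟨glue (!c) χ₀ χ₁, (constBelow_series hi).2 ⟨hχ₀, hχ₁.mono hcmp.le⟩, ?_⟩
        rw [(ends_series hi _ _ _ k).1]
        change (ends i χ₀ c (!c) k).1 ≠ (ends i χ₀ c (!c) k).2
        rw [ends_bottleneck (by omega) h0 hχ₀]
        exact hcn

/-- If `u` makes `t` the bottleneck edge, `InTree i t` is the minimum spanning tree of the network,
described by cuts. -/
theorem inTree_iff {i : ℕ} {u : ℕ → ℝ} {t x : ℕ} (ht : t < 2 ^ i) (hx : x < 2 ^ i)
    (hu : BottleneckOrder i u t) : InTree i t x ↔ ∃ χ cs ct, ConstBelow i u (u x) χ cs ct ∧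
      (ends i χ cs ct x).1 ≠ (ends i χ cs ct x).2 := by
  constructor
  · rintro (h | rfl)
    · obtain ⟨χ, h1, h2⟩ := exists_constBelow_of_outTree ht hx hu h false
      exact ⟨χ, _, _, h1, h2⟩
    · obtain ⟨χ, h⟩ := exists_constBelow_bottleneck hx hu false true
      exact ⟨χ, _, _, h, by rw [ends_bottleneck hx hu h]; simp⟩
  · rintro ⟨χ, cs, ct, h1, h2⟩
    by_contra hcon
    exact h2 (ends_eq_of_not_inTree ht hx hu hcon h1)

end Network

/-! ### Lines that realize the bottleneck orders -/

section Lines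

lemma isOpen_bottleneckOrder (i t : ℕ) : IsOpen {u : ℕ → ℝ | BottleneckOrder i u t} := by
  induction i generalizing t with
  | zero => simp [BottleneckOrder]
  | succ i ih =>
    have h1 : ∀ b : ℕ, IsOpen {u : ℕ → ℝ | BottleneckOrder i (fun q => u (2 * q + b)) (t / 2)} :=
      fun b => (ih (t / 2)).preimage (f := fun (u : ℕ → ℝ) q => u (2 * q + b)) (by fun_prop)
    have h2 : IsOpen {u : ℕ → ℝ | ∀ b < 2, BottleneckOrder i (fun q => u (2 * q + b)) (t / 2)} := by
      have : {u : ℕ → ℝ | ∀ b < 2, BottleneckOrder i (fun q => u (2 * q + b)) (t / 2)} =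
          {u | BottleneckOrder i (fun q => u (2 * q + 0)) (t / 2)} ∩
          {u | BottleneckOrder i (fun q => u (2 * q + 1)) (t / 2)} := by
        ext u
        exact ⟨fun h => ⟨h 0 (by norm_num), h 1 (by norm_num)⟩, fun h b hb => by
          interval_cases b; exacts [h.1, h.2]⟩
      rw [this]
      exact (h1 0).inter (h1 1)
    have h3 : IsOpen {u : ℕ → ℝ | if Even i then u (twin t) < u t else u t < u (twin t)} := by
      by_cases hi : Even i
      · simpa only [if_pos hi] using isOpen_lt (continuous_apply (twin t)) (continuous_apply t)
      · simpa only [if_neg hi] using isOpen_lt (continuous_apply t) (continuous_apply (twin t))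
    exact h2.inter h3

open Filter Topology in
/-- There are lines, and times in increasing order, such that at each time the bottleneck is the
edge of the same number. For the next depth, every time splits into two times close to it; one copy
of the network keeps its lines, and in the other copy the line of edge `q` is tilted slightly about
its point at time `q`, where the bottleneck thus changes from one copy to the other. -/
theorem exists_lines (i : ℕ) : ∃ a b τ : ℕ → ℝ, (∀ t, t + 1 < 2 ^ i → τ t < τ (t + 1)) ∧
    ∀ t < 2 ^ i, BottleneckOrder i (fun x => a x * τ t + b x) t := by
  induction i with
  | zero => exact ⟨0, 0, 0, fun t ht => by simp at ht, fun _ _ => trivial⟩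
  | succ i ih =>
    obtain ⟨a, b, τ, hτ, hu⟩ := ih
    have near : ∀ (σ : ℝ) (k : ℕ), k < 2 ^ i → ∀ᶠ δ in 𝓝[>] (0 : ℝ),
        BottleneckOrder i (fun x => a x * (τ k + σ * δ) + b x) k := by
      intro σ k hk
      have hc : Continuous (fun (δ : ℝ) (x : ℕ) => a x * (τ k + σ * δ) + b x) := by fun_prop
      refine nhdsWithin_le_nhds (hc.continuousAt.eventually_mem
        ((isOpen_bottleneckOrder i k).mem_nhds ?_))
      simpa using hu k hk
    have gap : ∀ k, k + 1 < 2 ^ i → ∀ᶠ δ in 𝓝[>] (0 : ℝ), τ k + δ < τ (k + 1) - δ := by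
      intro k hk
      have hc : Continuous (fun δ : ℝ => τ (k + 1) - δ - (τ k + δ)) := by fun_prop
      refine nhdsWithin_le_nhds ((hc.continuousAt.eventually_mem
        (isOpen_Ioi.mem_nhds (show (0 : ℝ) < _ by simpa using hτ k hk))).mono fun δ h => ?_)
      linarith [show (0 : ℝ) < _ from h]
    obtain ⟨δ, hδ0, hδ1, hδ2, hδ3⟩ : ∃ δ : ℝ, 0 < δ ∧
        (∀ k < 2 ^ i, BottleneckOrder i (fun x => a x * (τ k + -1 * δ) + b x) k) ∧
        (∀ k < 2 ^ i, BottleneckOrder i (fun x => a x * (τ k + 1 * δ) + b x) k) ∧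
        ∀ k < 2 ^ i, k + 1 < 2 ^ i → τ k + δ < τ (k + 1) - δ := by
      have h := (eventually_mem_nhdsWithin : ∀ᶠ δ in 𝓝[>] (0 : ℝ), δ ∈ Set.Ioi (0 : ℝ))
      have h1 := (Filter.eventually_all_finset (Finset.range (2 ^ i))).2
        (fun k hk => near (-1) k (Finset.mem_range.1 hk))
      have h2 := (Filter.eventually_all_finset (Finset.range (2 ^ i))).2
        (fun k hk => near 1 k (Finset.mem_range.1 hk))
      have h3 : ∀ᶠ δ in 𝓝[>] (0 : ℝ), ∀ k ∈ Finset.range (2 ^ i), k + 1 < 2 ^ i →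
          τ k + δ < τ (k + 1) - δ :=
        (Filter.eventually_all_finset _).2 (fun k _ => by
          by_cases hk : k + 1 < 2 ^ i
          · exact (gap k hk).mono fun _ h _ => h
          · exact Filter.Eventually.of_forall fun _ h => absurd h hk)
      obtain ⟨δ, ⟨⟨h, h1⟩, h2⟩, h3⟩ := (((h.and h1).and h2).and h3).exists
      exact ⟨δ, h, fun k hk => h1 k (Finset.mem_range.2 hk), fun k hk => h2 k (Finset.mem_range.2 hk),
        fun k hk => h3 k (Finset.mem_range.2 hk)⟩
    -- In a series connection the copies exchange the role of the heavier bottleneck edge, in a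
    -- parallel connection that of the lighter one.
    set s : ℝ := if Even i then 1 else -1 with hs
    have tilt : ∀ (σ : ℝ) (k : ℕ), BottleneckOrder i (fun x => a x * (τ k + σ * δ) + b x) k →
        ∀ᶠ ε in 𝓝[>] (0 : ℝ), BottleneckOrder i
          (fun x => (a x + ε * s) * (τ k + σ * δ) + (b x - ε * s * τ x)) k := by
      intro σ k hk
      have hc : Continuous (fun (ε : ℝ) (x : ℕ) =>
          (a x + ε * s) * (τ k + σ * δ) + (b x - ε * s * τ x)) := by fun_prop
      refine nhdsWithin_le_nhds (hc.continuousAt.eventually_mem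
        ((isOpen_bottleneckOrder i k).mem_nhds ?_))
      simpa using hk
    obtain ⟨ε, hε0, hε1, hε2⟩ : ∃ ε : ℝ, 0 < ε ∧
        (∀ k < 2 ^ i, BottleneckOrder i
          (fun x => (a x + ε * s) * (τ k + -1 * δ) + (b x - ε * s * τ x)) k) ∧
        ∀ k < 2 ^ i, BottleneckOrder i
          (fun x => (a x + ε * s) * (τ k + 1 * δ) + (b x - ε * s * τ x)) k := by
      have h := (eventually_mem_nhdsWithin : ∀ᶠ δ in 𝓝[>] (0 : ℝ), δ ∈ Set.Ioi (0 : ℝ))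
      have h1 := (Filter.eventually_all_finset (Finset.range (2 ^ i))).2
        (fun k hk => tilt (-1) k (hδ1 k (Finset.mem_range.1 hk)))
      have h2 := (Filter.eventually_all_finset (Finset.range (2 ^ i))).2
        (fun k hk => tilt 1 k (hδ2 k (Finset.mem_range.1 hk)))
      obtain ⟨ε, ⟨h, h1⟩, h2⟩ := ((h.and h1).and h2).exists
      exact ⟨ε, h, fun k hk => h1 k (Finset.mem_range.2 hk), fun k hk => h2 k (Finset.mem_range.2 hk)⟩
    have d0 : ∀ k, 2 * k / 2 = k := fun k => by omega
    have d1 : ∀ k, (2 * k + 1) / 2 = k := fun k => by omega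
    have m0 : ∀ k, 2 * k % 2 = 0 := fun k => by omega
    have m1 : ∀ k, (2 * k + 1) % 2 = 1 := fun k => by omega
    refine ⟨fun x => a (x / 2) + (x % 2 : ℕ) * (ε * s),
      fun x => b (x / 2) - (x % 2 : ℕ) * (ε * s * τ (x / 2)),
      fun t => τ (t / 2) + (2 * (t % 2 : ℕ) - 1) * δ, ?_, ?_⟩
    · intro t ht
      rw [pow_succ] at ht
      obtain ⟨k, rfl | rfl⟩ : ∃ k, t = 2 * k ∨ t = 2 * k + 1 := ⟨t / 2, by omega⟩
      · simp only [d0, d1, m0, m1]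
        push_cast
        linarith
      · rw [show 2 * k + 1 + 1 = 2 * (k + 1) by ring]
        simp only [d0, d1, m0, m1]
        push_cast
        linarith [hδ3 k (by omega) (by omega)]
    · intro t ht
      rw [pow_succ] at ht
      have hse : 0 < s * s * (ε * δ) := by
        have : s * s = 1 := by rw [hs]; split_ifs <;> norm_num
        rw [this, one_mul]; exact mul_pos hε0 hδ0
      have hεδ : 0 < ε * δ := mul_pos hε0 hδ0
      obtain ⟨k, rfl | rfl⟩ : ∃ k, t = 2 * k ∨ t = 2 * k + 1 := ⟨t / 2, by omega⟩
      · have hk : k < 2 ^ i := by omega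
        refine ⟨fun b hb => ?_, ?_⟩
        · interval_cases b
          · simp only [add_zero, d0, m0]
            convert hδ1 k hk using 2
            push_cast; ring
          · simp only [d0, d1, m0, m1]
            convert hε1 k hk using 2
            push_cast; ring
        · simp only [twin_two_mul, d0, d1, m0, m1]
          push_cast
          split_ifs with hi
          · rw [if_pos hi] at hs
            rw [hs]; nlinarith
          · rw [if_neg hi] at hs
            rw [hs]; nlinarith
      · have hk : k < 2 ^ i := by omega
        refine ⟨fun b hb => ?_, ?_⟩
        · interval_cases b
          · simp only [add_zero, d0, d1, m0, m1]
            convert hδ2 k hk using 2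
            push_cast; ring
          · simp only [d1, m1]
            convert hε2 k hk using 2
            push_cast; ring
        · simp only [twin_two_mul_add_one, d0, d1, m0, m1]
          push_cast
          split_ifs with hi
          · rw [if_pos hi] at hs
            rw [hs]; nlinarith
          · rw [if_neg hi] at hs
            rw [hs]; nlinarith

end Lines

section Count

lemma outTree_iff {i v t x : ℕ} (hv : v < i) (h1 : t / 2 ^ (v + 1) = x / 2 ^ (v + 1))
    (h2 : t / 2 ^ v ≠ x / 2 ^ v) : OutTree i t x ↔ Even (i - 1 - v) := by
  induction v generalizing i t x with
  | zero =>
    obtain ⟨i, rfl⟩ : ∃ j, i = j + 1 := ⟨i - 1, by omega⟩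
    simp only [pow_zero, Nat.div_one, zero_add, pow_one] at h1 h2
    simp only [OutTree, h1, outTree_self, false_or, true_and, add_tsub_cancel_right, tsub_zero]
    exact ⟨fun h => h.1, fun h => ⟨h, h2.symm⟩⟩
  | succ v ih =>
    obtain ⟨i, rfl⟩ : ∃ j, i = j + 1 := ⟨i - 1, by omega⟩
    have e : ∀ y w : ℕ, y / 2 / 2 ^ w = y / 2 ^ (w + 1) := fun y w => by
      rw [Nat.div_div_eq_div_mul, pow_succ']
    have h3 : x / 2 ≠ t / 2 := by
      intro h
      apply h2
      rw [← e, ← e, h]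
    simp only [OutTree, h3, false_and, and_false, or_false]
    rw [ih (by omega) (by rw [e, e]; exact h1) (by rw [e, e]; exact h2)]
    congr! 1
    omega

/-- The edges that leave the tree between consecutive times. -/
noncomputable def leaving (i : ℕ) : Finset (Σ _ : ℕ, ℕ) :=
  open Classical in
  (Finset.range (2 ^ i - 1)).sigma (fun t =>
    (Finset.range (2 ^ i)).filter (fun x => InTree i t x ∧ ¬ InTree i (t + 1) x))

/-- In the network of depth `2 * j`, at least `j * 4 ^ (j - 1)` edges leave the tree. For a binary
prefix `p` of even length, each edge with number `p11…` leaves it between the times `p01…1` and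
`p10…0`: it differs from the former at an even position, and from the latter at an odd one. -/
theorem card_leaving (j : ℕ) : j * 4 ^ (j - 1) ≤ (leaving (2 * j)).card := by
  classical
  have hcard : ((Finset.range j) ×ˢ (Finset.range (4 ^ (j - 1)))).card = j * 4 ^ (j - 1) := by simp
  rw [← hcard]
  have hodd : ∀ q q' m m' : ℕ, m < m' → (2 * q + 1) * 2 ^ (m + 1) ≠ (2 * q' + 1) * 2 ^ (m' + 1) := by
    intro q q' m m' hm h
    obtain ⟨d, rfl⟩ : ∃ d, m' = m + d + 1 := ⟨m' - m - 1, by omega⟩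
    have h2 : 0 < 2 ^ (m + 1) := by positivity
    have h3 : (2 * q + 1) * 2 ^ (m + 1) = (2 * ((2 * q' + 1) * 2 ^ d)) * 2 ^ (m + 1) := by
      rw [h]; ring
    have := Nat.eq_of_mul_eq_mul_right h2 h3
    omega
  refine Finset.card_le_card_of_injOn (fun p =>
    let m := 2 * (j - 1 - p.1)
    ⟨(2 * (p.2 / 2 ^ m) + 1) * 2 ^ (m + 1) - 1, (4 * (p.2 / 2 ^ m) + 3) * 2 ^ m + p.2 % 2 ^ m⟩) ?_ ?_
  · rintro ⟨r, y⟩ hp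
    simp only [Finset.coe_product, Finset.coe_range, Set.mem_prod, Set.mem_Iio] at hp
    obtain ⟨hr, hy⟩ := hp
    simp only
    set m := 2 * (j - 1 - r) with hm
    set q := y / 2 ^ m with hq
    have hz := Nat.mod_lt y (show 0 < 2 ^ m by positivity)
    set z := y % 2 ^ m with hz'
    have h2m : 0 < 2 ^ m := by positivity
    have hpow1 : 2 ^ (m + 1) = 2 * 2 ^ m := by ring
    have hpow2 : 2 ^ (m + 1 + 1) = 4 * 2 ^ m := by ring
    have hL : 2 * j = 2 * r + 2 + m := by omega
    have hpowL : 2 ^ (2 * j) = 4 * 2 ^ (2 * r) * 2 ^ m := by rw [hL]; ring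
    have hq4 : q < 2 ^ (2 * r) := by
      rw [hq, Nat.div_lt_iff_lt_mul h2m, ← pow_add, show 2 * r + m = 2 * (j - 1) by omega, pow_mul]
      exact hy
    have hle : (q + 1) * 2 ^ m ≤ 2 ^ (2 * r) * 2 ^ m := Nat.mul_le_mul_right _ hq4
    have hqm : (q + 1) * 2 ^ m = q * 2 ^ m + 2 ^ m := by ring
    have e1 : (2 * q + 1) * 2 ^ (m + 1) = 4 * (q * 2 ^ m) + 2 * 2 ^ m := by rw [hpow1]; ring
    have e0 : 2 * q * 2 ^ (m + 1) = 4 * (q * 2 ^ m) := by rw [hpow1]; ring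
    have e3 : (4 * q + 2) * 2 ^ m = 4 * (q * 2 ^ m) + 2 * 2 ^ m := by ring
    have e2 : (4 * q + 3) * 2 ^ m = 4 * (q * 2 ^ m) + 3 * 2 ^ m := by ring
    have div1 : ∀ c w k : ℕ, k * c ≤ w → w < k * c + c → w / c = k := by
      intro c w k h1 h2
      exact Nat.div_eq_of_lt_le h1 (by rw [Nat.succ_mul]; exact h2)
    rw [leaving, Finset.mem_coe, Finset.mem_sigma, Finset.mem_range, Finset.mem_filter,
      Finset.mem_range]
    simp only
    rw [e1, e2, hpowL, show 4 * (q * 2 ^ m) + 2 * 2 ^ m - 1 + 1 = 4 * (q * 2 ^ m) + 2 * 2 ^ m by omega]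
    have hle' : 4 * (q * 2 ^ m) + 4 * 2 ^ m ≤ 4 * 2 ^ (2 * r) * 2 ^ m := by
      rw [mul_assoc]; omega
    refine ⟨by omega, by omega, Or.inl ?_, ?_⟩
    · rw [outTree_iff (v := m + 1) (by omega)]
      · exact ⟨r, by omega⟩
      · rw [div1 _ _ q, div1 _ _ q] <;> rw [hpow2, show q * (4 * 2 ^ m) = 4 * (q * 2 ^ m) by ring] <;>
          omega
      · rw [div1 _ _ (2 * q), div1 _ (_ + _) (2 * q + 1)]
        · omega
        all_goals omega
    · rintro (h | h)
      · rw [outTree_iff (v := m) (by omega)] at h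
        · rw [show 2 * j - 1 - m = 2 * r + 1 by omega] at h
          exact Nat.not_even_bit1 r h
        · rw [div1 _ _ (2 * q + 1), div1 _ _ (2 * q + 1)] <;> omega
        · rw [div1 _ _ (4 * q + 2), div1 _ (_ + _) (4 * q + 3)]
          · omega
          all_goals omega
      · omega
  · rintro ⟨r, y⟩ hp ⟨r', y'⟩ hp' heq
    simp only [Finset.coe_product, Finset.coe_range, Set.mem_prod, Set.mem_Iio] at hp hp'
    simp only [Sigma.mk.injEq, heq_eq_eq] at heq
    obtain ⟨h1, h2⟩ := heq
    have p1 : 0 < (2 * (y / 2 ^ (2 * (j - 1 - r))) + 1) * 2 ^ (2 * (j - 1 - r) + 1) := by positivity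
    have p2 : 0 < (2 * (y' / 2 ^ (2 * (j - 1 - r'))) + 1) * 2 ^ (2 * (j - 1 - r') + 1) := by positivity
    have h3 : (2 * (y / 2 ^ (2 * (j - 1 - r))) + 1) * 2 ^ (2 * (j - 1 - r) + 1) =
      (2 * (y' / 2 ^ (2 * (j - 1 - r'))) + 1) * 2 ^ (2 * (j - 1 - r') + 1) := by omega
    have hr : r = r' := by
      rcases lt_trichotomy r r' with h | h | h
      · exact absurd h3.symm (hodd _ _ _ _ (by omega))
      · exact h
      · exact absurd h3 (hodd _ _ _ _ (by omega))
    subst hr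
    have h4 := Nat.eq_of_mul_eq_mul_right (by positivity) h3
    have h5 : y / 2 ^ (2 * (j - 1 - r)) = y' / 2 ^ (2 * (j - 1 - r)) := by omega
    rw [h5] at h2
    have h6 : y % 2 ^ (2 * (j - 1 - r)) = y' % 2 ^ (2 * (j - 1 - r)) := by omega
    rw [← Nat.div_add_mod y (2 ^ (2 * (j - 1 - r))), ← Nat.div_add_mod y' (2 ^ (2 * (j - 1 - r))),
      h5, h6]

end Count

/-! ### Placing the network on the natural numbers -/

section Placement

/-- The nodes of the infinite binary tree are numbered from `1` as in a binary heap. This is the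
number of the node reached from node `ν` along the path `l`. -/
def heap (ν : ℕ) (l : List Bool) : ℕ := l.foldl (fun n b => 2 * n + b.toNat) ν

lemma heap_cons (ν : ℕ) (b : Bool) (l : List Bool) :
    heap ν (b :: l) = heap (2 * ν + b.toNat) l := rfl

lemma heap_pos (l : List Bool) : 1 ≤ heap 1 l := by
  induction l using List.reverseRecOn with
  | nil => exact le_rfl
  | append_singleton l b ih =>
    simp only [heap, List.foldl_append, List.foldl_cons, List.foldl_nil] at ih ⊢
    omega

lemma heap_injective : Function.Injective (heap 1) := by
  intro l l' h
  induction l using List.reverseRecOn generalizing l' with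
  | nil =>
    induction l' using List.reverseRecOn with
    | nil => rfl
    | append_singleton l' b' _ =>
      have := heap_pos l'
      simp only [heap, List.foldl_append, List.foldl_cons, List.foldl_nil] at h this
      omega
  | append_singleton l b ih =>
    have h1 := heap_pos l
    induction l' using List.reverseRecOn with
    | nil =>
      simp only [heap, List.foldl_append, List.foldl_cons, List.foldl_nil] at h h1
      omega
    | append_singleton l' b' _ =>
      have hb : b = b' ∧ heap 1 l = heap 1 l' := by
        simp only [heap, List.foldl_append, List.foldl_cons, List.foldl_nil] at h ⊢
        cases b <;> cases b' <;> simp at h ⊢ <;> omega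
      rw [hb.1, ih hb.2]

/-- The terminals of the subnetwork at node `ν`, if series connections are at odd depth. The
terminals of the whole network are `0` and `1`, and the inner vertex of node `ν` is `ν + 1`. -/
def terminals (ν : ℕ) : ℕ × ℕ :=
  if ν ≤ 1 then (0, 1)
  else if Odd (Nat.log 2 (ν / 2)) then
    if ν % 2 = 0 then ((terminals (ν / 2)).1, ν / 2 + 1)
    else (ν / 2 + 1, (terminals (ν / 2)).2)
  else terminals (ν / 2)
decreasing_by all_goals omega

lemma terminals_one : terminals 1 = (0, 1) := by rw [terminals]; simp

lemma terminals_lt (ν : ℕ) (hν : 1 ≤ ν) : (terminals ν).1 < ν + 1 ∧ (terminals ν).2 < ν + 1 ∧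
    (terminals ν).1 ≠ (terminals ν).2 := by
  induction ν using Nat.strong_induction_on with
  | _ ν ih =>
    rw [terminals]
    split_ifs with h1 h2 h3
    · simp; omega
    · have := ih (ν / 2) (by omega) (by omega)
      simp only
      omega
    · have := ih (ν / 2) (by omega) (by omega)
      simp only
      omega
    · have := ih (ν / 2) (by omega) (by omega)
      omega

/-- The number of the leaf that stands for edge `q` of the subnetwork of depth `i` at node `ν`. -/
def leafIdx : ℕ → ℕ → ℕ → ℕ
  | 0, ν, _ => ν
  | i + 1, ν, q => leafIdx i (2 * ν + q % 2) (q / 2)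

lemma ends_heap {i ν : ℕ} (hν : 1 ≤ ν) (hi : Even (i + Nat.log 2 ν)) (q : ℕ) :
    ends i (fun l => heap ν l + 1) (terminals ν).1 (terminals ν).2 q =
      terminals (leafIdx i ν q) := by
  induction i generalizing ν q with
  | zero => rfl
  | succ i ih =>
    have hlog : ∀ b < 2, Nat.log 2 (2 * ν + b) = Nat.log 2 ν + 1 := by
      intro b hb
      rw [Nat.log_of_one_lt_of_le (by norm_num) (by omega)]
      congr 2
      omega
    have hpar : Even i ↔ Odd (Nat.log 2 ν) := by
      rw [show i + 1 + Nat.log 2 ν = (i + Nat.log 2 ν) + 1 by ring, Nat.even_add_one,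
        Nat.even_add] at hi
      rw [← Nat.not_even_iff_odd]
      tauto
    have hi' : ∀ b < 2, Even (i + Nat.log 2 (2 * ν + b)) := by
      intro b hb
      rw [hlog b hb]
      rwa [show i + (Nat.log 2 ν + 1) = i + 1 + Nat.log 2 ν by ring]
    have ht : ∀ b < 2, terminals (2 * ν + b) = if Odd (Nat.log 2 ν) then
        if b = 0 then ((terminals ν).1, ν + 1) else (ν + 1, (terminals ν).2)
        else terminals ν := by
      intro b hb
      rw [terminals, if_neg (by omega), show (2 * ν + b) / 2 = ν by omega,
        show (2 * ν + b) % 2 = b by omega]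
    simp only [ends, leafIdx]
    have hq : q % 2 < 2 := Nat.mod_lt _ (by norm_num)
    rw [← ih (by omega) (hi' _ hq), ht _ hq]
    simp only [heap_cons]
    by_cases he : Even i
    · rw [if_pos he, if_pos (hpar.1 he)]
      by_cases h0 : q % 2 = 0
      · simp [h0, heap]
      · have h1 : q % 2 = 1 := by omega
        simp [h1, heap]
    · rw [if_neg he, if_neg (fun h => he (hpar.2 h))]
      rcases Nat.mod_two_eq_zero_or_one q with h0 | h1
      · simp [h0]
      · simp [h1]

lemma leafIdx_bounds (i ν q : ℕ) : 2 ^ i * ν ≤ leafIdx i ν q ∧ leafIdx i ν q < 2 ^ i * (ν + 1) := by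
  induction i generalizing ν q with
  | zero => simp [leafIdx]
  | succ i ih =>
    obtain ⟨h1, h2⟩ := ih (2 * ν + q % 2) (q / 2)
    have hq : q % 2 < 2 := Nat.mod_lt _ (by norm_num)
    simp only [leafIdx]
    constructor
    · refine le_trans ?_ h1
      rw [pow_succ, mul_assoc]
      exact Nat.mul_le_mul_left _ (by omega)
    · refine lt_of_lt_of_le h2 ?_
      rw [pow_succ, mul_assoc]
      exact Nat.mul_le_mul_left _ (by omega)

lemma leafIdx_inj {i ν ν' q q' : ℕ} (hq : q < 2 ^ i) (hq' : q' < 2 ^ i)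
    (h : leafIdx i ν q = leafIdx i ν' q') : ν = ν' ∧ q = q' := by
  induction i generalizing ν ν' q q' with
  | zero => simp at hq hq'; exact ⟨h, by omega⟩
  | succ i ih =>
    rw [pow_succ] at hq hq'
    have := ih (by omega) (by omega) h
    omega

/-- A graph in which each vertex `v ≥ 2` is joined to two earlier vertices has an injective
labelling by natural numbers, of linear size, with different label differences on different edges:
labels are chosen greedily. -/
lemma exists_labelling (p : Bool → ℕ → ℕ) (hp : ∀ b, ∀ v, 2 ≤ v → p b v < v)
    (hne : ∀ v, 2 ≤ v → p false v ≠ p true v) (N : ℕ) : ∃ X : ℕ → ℕ,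
      (∀ v < N, X v ≤ 9 * v + 1) ∧ (∀ v < N, ∀ v' < N, X v = X v' → v = v') ∧
      ∀ v < N, ∀ v' < N, 2 ≤ v → 2 ≤ v' → ∀ b b',
        Nat.dist (X v) (X (p b v)) = Nat.dist (X v') (X (p b' v')) → v = v' ∧ b = b' := by
  classical
  induction N with
  | zero => exact ⟨id, by simp, by simp, by simp⟩
  | succ N ih =>
    obtain ⟨X, h1, h2, h3⟩ := ih
    set D : ℕ × Bool → ℕ := fun e => Nat.dist (X e.1) (X (p e.2 e.1)) with hD
    -- The labels that would repeat a label, repeat a difference, or give the new vertex two equal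
    -- differences.
    set B₁ : Finset ℕ := (Finset.range N).image X
    set B₂ : Finset ℕ := ((Finset.range N) ×ˢ (Finset.univ : Finset (Bool × Bool × Bool))).image
      (fun e => if e.2.2.2 then X (p e.2.2.1 N) + D (e.1, e.2.1) else X (p e.2.2.1 N) - D (e.1, e.2.1))
    set B₃ : Finset ℕ := {(X (p false N) + X (p true N)) / 2}
    have hB : (B₁ ∪ B₂ ∪ B₃).card < (Finset.range (9 * N + 2)).card := by
      have c1 : B₁.card ≤ N := Finset.card_image_le.trans (by simp)
      have c2 : B₂.card ≤ N * 8 := Finset.card_image_le.trans (by simp)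
      have c3 : B₃.card = 1 := Finset.card_singleton _
      have c4 := Finset.card_union_le (B₁ ∪ B₂) B₃
      have c5 := Finset.card_union_le B₁ B₂
      rw [Finset.card_range]
      omega
    obtain ⟨x, hx, hxB⟩ := Finset.exists_mem_notMem_of_card_lt_card hB
    rw [Finset.mem_range] at hx
    simp only [Finset.mem_union, not_or] at hxB
    obtain ⟨⟨hx1, hx2⟩, hx3⟩ := hxB
    have x1 : ∀ v < N, X v ≠ x := fun v hv h =>
      hx1 (Finset.mem_image.2 ⟨v, Finset.mem_range.2 hv, h⟩)
    have x2 : ∀ v < N, ∀ b b', Nat.dist x (X (p b N)) ≠ Nat.dist (X v) (X (p b' v)) := by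
      intro v hv b b' h
      have hmem : ∀ s : Bool, (if s then X (p b N) + D (v, b') else X (p b N) - D (v, b')) ∈ B₂ :=
        fun s => Finset.mem_image.2 ⟨(v, b', b, s), by simp [hv], rfl⟩
      have m1 := hmem true
      have m2 := hmem false
      simp only [if_true, Bool.false_eq_true, if_false, hD, ← h] at m1 m2
      unfold Nat.dist at m1 m2
      rcases le_total x (X (p b N)) with hle | hle
      · rw [show X (p b N) - (x - X (p b N) + (X (p b N) - x)) = x by omega] at m2
        exact hx2 m2
      · rw [show X (p b N) + (x - X (p b N) + (X (p b N) - x)) = x by omega] at m1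
        exact hx2 m1
    have u1 : ∀ v < N, Function.update X N x v = X v := fun v hv =>
      Function.update_of_ne hv.ne _ _
    have u2 : Function.update X N x N = x := Function.update_self ..
    have x3 : 2 ≤ N → Nat.dist x (X (p false N)) ≠ Nat.dist x (X (p true N)) := by
      intro hN h
      have hpp : X (p false N) ≠ X (p true N) := fun h =>
        hne N hN (h2 _ (hp _ _ hN) _ (hp _ _ hN) h)
      have : x ≠ (X (p false N) + X (p true N)) / 2 := fun h => hx3 (Finset.mem_singleton.2 h)
      unfold Nat.dist at h
      omega
    refine ⟨Function.update X N x, ?_, ?_, ?_⟩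
    · intro v hv
      rcases Nat.lt_succ_iff_lt_or_eq.1 hv with hv | rfl
      · rw [u1 v hv]; exact h1 v hv
      · rw [u2]; omega
    · intro v hv v' hv' h
      rcases Nat.lt_succ_iff_lt_or_eq.1 hv with hv | rfl <;>
      rcases Nat.lt_succ_iff_lt_or_eq.1 hv' with hv' | rfl
      · rw [u1 v hv, u1 v' hv'] at h; exact h2 v hv v' hv' h
      · rw [u1 v hv, u2] at h; exact absurd h (x1 v hv)
      · rw [u1 v' hv', u2] at h; exact absurd h.symm (x1 v' hv')
      · rfl
    · intro v hv v' hv' h2v h2v' b b' h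
      have hb := hp b v h2v
      have hb' := hp b' v' h2v'
      rw [u1 (p b v) (by omega), u1 (p b' v') (by omega)] at h
      rcases Nat.lt_succ_iff_lt_or_eq.1 hv with hv | rfl <;>
      rcases Nat.lt_succ_iff_lt_or_eq.1 hv' with hv' | rfl
      · rw [u1 v hv, u1 v' hv'] at h; exact h3 v hv v' hv' h2v h2v' b b' h
      · rw [u1 v hv, u2] at h; exact absurd h.symm (x2 v hv b' b)
      · rw [u1 v' hv', u2] at h; exact absurd h (x2 v' hv' b b')
      · rw [u2] at h
        refine ⟨rfl, ?_⟩
        cases b <;> cases b'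
        · rfl
        · exact absurd h (x3 h2v)
        · exact absurd h.symm (x3 h2v)
        · rfl

/-- The network of depth `2 * j` can be placed on the natural numbers up to `9 * 4 ^ j + 1`, with
different edges of different lengths, so that its translates are edge-disjoint. The placement is
injective on the vertices, so that it turns every colouring of the network into one of `ℕ`. -/
theorem exists_placement {j : ℕ} (hj : 1 ≤ j) : ∃ (μ : List Bool → ℕ) (s t : ℕ),
    (∀ q < 2 ^ (2 * j), (ends (2 * j) μ s t q).1 ≤ 9 * 4 ^ j + 1 ∧
      (ends (2 * j) μ s t q).2 ≤ 9 * 4 ^ j + 1 ∧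
      (ends (2 * j) μ s t q).1 ≠ (ends (2 * j) μ s t q).2) ∧
    (∀ q < 2 ^ (2 * j), ∀ q' < 2 ^ (2 * j),
      Nat.dist (ends (2 * j) μ s t q).1 (ends (2 * j) μ s t q).2 =
        Nat.dist (ends (2 * j) μ s t q').1 (ends (2 * j) μ s t q').2 → q = q') ∧
    ∀ (χ : List Bool → Bool) (cs ct : Bool), ∃ c : ℕ → Bool, ∀ q < 2 ^ (2 * j),
      Prod.map c c (ends (2 * j) μ s t q) = ends (2 * j) χ cs ct q := by
  classical
  set p : Bool → ℕ → ℕ := fun b v => if b then (terminals (v - 1)).2 else (terminals (v - 1)).1 with hpdef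
  have hlt : ∀ v, 2 ≤ v → (terminals (v - 1)).1 < v ∧ (terminals (v - 1)).2 < v ∧
      (terminals (v - 1)).1 ≠ (terminals (v - 1)).2 := fun v hv => by
    have := terminals_lt (v - 1) (by omega)
    omega
  obtain ⟨X, X1, X2, X3⟩ := exists_labelling p
    (fun b v hv => by cases b; exacts [(hlt v hv).1, (hlt v hv).2.1])
    (fun v hv => (hlt v hv).2.2) (4 ^ j + 1)
  have h4 : 2 ^ (2 * j) = 4 ^ j := by rw [pow_mul]; norm_num
  -- Edge `q` joins the inner vertex `v` of a series connection of two edges to a terminal of it.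
  have hedge : ∀ q < 2 ^ (2 * j), ∃ (v : ℕ) (b : Bool), 2 ≤ v ∧ v < 4 ^ j + 1 ∧
      leafIdx (2 * j) 1 q = 2 * (v - 1) + b.toNat ∧
      terminals (leafIdx (2 * j) 1 q) = if b then (v, p b v) else (p b v, v) := by
    intro q hq
    obtain ⟨hb1, hb2⟩ := leafIdx_bounds (2 * j) 1 q
    set n := leafIdx (2 * j) 1 q with hn
    have h4' : 4 ≤ 4 ^ j := by
      calc 4 = 4 ^ 1 := by norm_num
        _ ≤ 4 ^ j := Nat.pow_le_pow_right (by norm_num) hj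
    rw [h4] at hb1 hb2
    have hlog : Odd (Nat.log 2 (n / 2)) := by
      have : Nat.log 2 (n / 2) = 2 * j - 1 := by
        rw [Nat.log_eq_iff (Or.inr ⟨by norm_num, by omega⟩)]
        have e1 : 2 ^ (2 * j - 1) * 2 = 4 ^ j := by
          rw [← pow_succ, ← h4]; congr 1; omega
        rw [pow_succ]
        omega
      rw [this]
      exact ⟨j - 1, by omega⟩
    refine ⟨n / 2 + 1, decide (n % 2 = 1), by omega, by omega, ?_, ?_⟩
    · rcases Nat.mod_two_eq_zero_or_one n with h | h <;> simp [h] <;> omega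
    · rw [terminals, if_neg (by omega), if_pos hlog]
      rcases Nat.mod_two_eq_zero_or_one n with h | h <;> simp [h, hpdef]
  have hends : ∀ q, ends (2 * j) (fun l => heap 1 l + 1) 0 1 q = terminals (leafIdx (2 * j) 1 q) := by
    intro q
    have := ends_heap (i := 2 * j) (ν := 1) le_rfl (by simp) q
    rwa [terminals_one] at this
  have hX : ∀ q, ends (2 * j) (fun l => X (heap 1 l + 1)) (X 0) (X 1) q =
      Prod.map X X (terminals (leafIdx (2 * j) 1 q)) := by
    intro q
    rw [← hends, map_ends]
    rfl
  have hpv : ∀ b, ∀ v, 2 ≤ v → v < 4 ^ j + 1 → p b v < 4 ^ j + 1 ∧ p b v ≠ v := by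
    intro b v hv hv'
    have := hlt v hv
    cases b
    · simp only [hpdef, Bool.false_eq_true, if_false]; omega
    · simp only [hpdef, if_true]; omega
  refine ⟨fun l => X (heap 1 l + 1), X 0, X 1, ?_, ?_, ?_⟩
  · intro q hq
    obtain ⟨v, b, hv, hv', -, ht⟩ := hedge q hq
    obtain ⟨hp1, hp2⟩ := hpv b v hv hv'
    have l1 := X1 v hv'
    have l2 := X1 _ hp1
    have l3 : X (p b v) ≠ X v := fun h => hp2 (X2 _ hp1 _ hv' h)
    rw [hX, ht]
    cases b
    · simp only [Bool.false_eq_true, if_false, Prod.map]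
      exact ⟨by omega, by omega, l3⟩
    · simp only [if_true, Prod.map]
      exact ⟨by omega, by omega, l3.symm⟩
  · intro q hq q' hq' h
    obtain ⟨v, b, hv, hv', hi, ht⟩ := hedge q hq
    obtain ⟨w, d, hw, hw', hi', ht'⟩ := hedge q' hq'
    rw [hX, hX, ht, ht'] at h
    have h' : Nat.dist (X v) (X (p b v)) = Nat.dist (X w) (X (p d w)) := by
      cases b <;> cases d <;>
        simpa [Prod.map, Nat.dist_comm] using h
    obtain ⟨rfl, rfl⟩ := X3 v hv' w hw' hv hw b d h'
    exact (leafIdx_inj hq hq' (hi.trans hi'.symm)).2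
  · intro χ cs ct
    set col : ℕ → Bool := fun v => if v = 0 then cs else if v = 1 then ct else
      Function.extend (heap 1) χ (fun _ => false) (v - 1) with hcol
    refine ⟨col ∘ Function.invFunOn X (Set.Iio (4 ^ j + 1)), ?_⟩
    have hinv : ∀ v < 4 ^ j + 1, Function.invFunOn X (Set.Iio (4 ^ j + 1)) (X v) = v := by
      intro v hv
      have : Set.InjOn X (Set.Iio (4 ^ j + 1)) := fun a ha b hb h => X2 a ha b hb h
      exact this.leftInvOn_invFunOn hv
    intro q hq
    have e1 : Prod.map col col (terminals (leafIdx (2 * j) 1 q)) = ends (2 * j) χ cs ct q := by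
      rw [← hends, map_ends]
      congr 1
      funext l
      have := heap_pos l
      simp only [hcol, Function.comp]
      rw [if_neg (by omega), if_neg (by omega), Nat.add_sub_cancel, heap_injective.extend_apply]
    rw [← e1, hX]
    obtain ⟨v, b, hv, hv', -, ht⟩ := hedge q hq
    have hp1 := (hpv b v hv hv').1
    rw [ht]
    cases b
    · simp [Prod.map, hinv _ hv', hinv _ hp1]
    · simp [Prod.map, hinv _ hv', hinv _ hp1]

end Placement

/-! ### Copies of the network in a large graph -/

section Copies

/-- The edge of the graph on `V` that stands for edge `q` of a network placed on `V`. -/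
def netEdge {V : Type*} (i : ℕ) (μ : List Bool → V) (s t : V) (q : ℕ) : Sym2 V :=
  s((ends i μ s t q).1, (ends i μ s t q).2)

/-- If the edges of a copy of the network are lighter than all other edges of a graph, the minimum
spanning tree of the graph contains exactly the edges of the minimum spanning tree of the copy. -/
lemma netEdge_mem_kruskalTree_iff {V : Type*} {G : SimpleGraph V} {w : Sym2 V → ℝ} {i : ℕ}
    {μ : List Bool → V} {a b : V} {t x : ℕ} (ht : t < 2 ^ i) (hx : x < 2 ^ i)
    (hu : BottleneckOrder i (fun q => w (netEdge i μ a b q)) t)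
    (hG : ∀ q < 2 ^ i, netEdge i μ a b q ∈ G.edgeSet)
    (hlight : ∀ f ∈ G.edgeSet, w f < w (netEdge i μ a b x) → ∃ q < 2 ^ i, f = netEdge i μ a b q)
    (hcol : ∀ (χ : List Bool → Bool) (cs ct : Bool), ∃ c : V → Bool, ∀ q < 2 ^ i,
      Prod.map c c (ends i μ a b q) = ends i χ cs ct q) :
    netEdge i μ a b x ∈ (kruskalTree G w).edgeSet ↔ InTree i t x := by
  rw [inTree_iff ht hx hu, netEdge, mem_kruskalTree_iff]
  constructor
  · rintro ⟨-, c, h1, h2⟩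
    refine ⟨c ∘ μ, c a, c b, fun q hq hlt => ?_, ?_⟩
    · rw [← map_ends]
      exact h1 _ _ (hG q hq) hlt
    · rw [← map_ends]
      exact h2
  · rintro ⟨χ, cs, ct, h1, h2⟩
    obtain ⟨c, hc⟩ := hcol χ cs ct
    refine ⟨hG x hx, c, fun v v' hadj hlt => ?_, ?_⟩
    · obtain ⟨q, hq, heq⟩ := hlight _ hadj hlt
      have h3 := h1 q hq (by rw [heq] at hlt; exact hlt)
      rw [← hc q hq] at h3
      rcases Sym2.eq_iff.1 heq with ⟨rfl, rfl⟩ | ⟨rfl, rfl⟩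
      · exact h3
      · exact h3.symm
    · rw [← hc x hx] at h2
      exact h2

lemma BottleneckOrder.add_const {i : ℕ} {u : ℕ → ℝ} {t : ℕ} (h : BottleneckOrder i u t) (κ : ℝ) :
    BottleneckOrder i (fun q => u q + κ) t := by
  induction i generalizing u t with
  | zero => trivial
  | succ i ih =>
    refine ⟨fun b hb => ih (h.1 b hb), ?_⟩
    have := h.2
    split_ifs at this ⊢ <;> linarith

lemma BottleneckOrder.congr {i : ℕ} {u v : ℕ → ℝ} {t : ℕ} (ht : t < 2 ^ i)
    (huv : ∀ q < 2 ^ i, u q = v q) (h : BottleneckOrder i u t) : BottleneckOrder i v t := by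
  induction i generalizing u v t with
  | zero => trivial
  | succ i ih =>
    have h2 : 2 ^ (i + 1) = 2 * 2 ^ i := by ring
    refine ⟨fun b hb => ih (by omega) (fun q hq => huv _ (by omega)) (h.1 b hb), ?_⟩
    rw [← huv _ ht, ← huv _ (twin_lt ht)]
    exact h.2

/-- In the window of copy `c₀`, the edges of every other copy `c` are heavier, because the lines of
the copies follow different tangents of a concave parabola; `d = c - c₀`. -/
lemma window_separation {M d τ a a' b b' : ℝ} (hM : 1 ≤ M) (hd : 1 ≤ |d|) (hτ : |τ| ≤ M)
    (ha : |a| ≤ M) (ha' : |a'| ≤ M) (hb : |b| ≤ M) (hb' : |b'| ≤ M) :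
    a * τ + b < 5 * M * (4 * M * d ^ 2 - 2 * d * τ) + (a' * (τ - 4 * M * d) + b') := by
  have h1 : |a * τ| ≤ M * M := by rw [abs_mul]; gcongr
  have h2 : |a' * τ| ≤ M * M := by rw [abs_mul]; gcongr
  have h3 : |a' * d| ≤ M * |d| := by rw [abs_mul]; gcongr
  have h4 : |d * τ| ≤ |d| * M := by rw [abs_mul]; gcongr
  have h5 : |d| ≤ d ^ 2 := by rw [← sq_abs]; nlinarith
  have h6 : M * |a' * d| ≤ M * (M * |d|) := by gcongr
  have h7 : M * |d * τ| ≤ M * (|d| * M) := by gcongr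
  have h8 : M * M * |d| ≤ M * M * d ^ 2 := by gcongr
  have h9 : M * M * 1 ≤ M * M * |d| := by gcongr
  have h10 : M * 1 ≤ M * M := by gcongr
  have e1 := (abs_le.1 h1).2
  have e2 := (abs_le.1 h2).1
  have e3 : M * (a' * d) ≤ M * |a' * d| := by gcongr; exact le_abs_self _
  have e4 : M * (d * τ) ≤ M * |d * τ| := by gcongr; exact le_abs_self _
  have e5 := (abs_le.1 hb).2
  have e6 := (abs_le.1 hb').1
  nlinarith

end Copies

section Assembly

open Filter Topology in
/-- The edges of given edge-disjoint copies of the network, in an arbitrary connected graph, can be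
labelled so that the copies become active one after the other: in the window of a copy, its edges
are lighter than all other edges of the graph and go through the bottleneck orders. -/
theorem exists_weights {V : Type*} [Fintype V] {G : SimpleGraph V} (hG : G.Connected) (i k : ℕ)
    (E : ℕ → ℕ → Sym2 V)
    (hinj : ∀ c < k, ∀ c' < k, ∀ q < 2 ^ i, ∀ q' < 2 ^ i, E c q = E c' q' → c = c' ∧ q = q') :
    ∃ (P : ParametricGraph V) (σ : ℕ → ℕ → ℝ), P.graph = G ∧ P.Generic ∧
      (∀ c ≤ k, ∀ t < 2 ^ i, P.NoTie (σ c t)) ∧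
      (∀ c, ∀ t, t + 1 < 2 ^ i → σ c t ≤ σ c (t + 1)) ∧
      (∀ c, σ c (2 ^ i - 1) ≤ σ (c + 1) 0) ∧
      ∀ c < k, ∀ t < 2 ^ i, BottleneckOrder i (fun q => P.weightAt (σ c t) (E c q)) t ∧
        ∀ f ∈ G.edgeSet, (∀ q < 2 ^ i, f ≠ E c q) → ∀ x < 2 ^ i,
          P.weightAt (σ c t) (E c x) < P.weightAt (σ c t) f := by
  classical
  obtain ⟨a, b, τ, hτ, hu⟩ := exists_lines i
  obtain ⟨M, hM1, hMa, hMb, hMτ⟩ : ∃ M : ℝ, 1 ≤ M ∧ (∀ q < 2 ^ i, |a q| ≤ M) ∧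
      (∀ q < 2 ^ i, |b q| ≤ M) ∧ ∀ q < 2 ^ i, |τ q| ≤ M := by
    obtain ⟨M, hM⟩ := Finset.exists_le (insert 1
      ((Finset.range (2 ^ i)).image (fun q => |a q|) ∪ (Finset.range (2 ^ i)).image (fun q => |b q|) ∪
        (Finset.range (2 ^ i)).image (fun q => |τ q|)))
    refine ⟨M, hM _ (Finset.mem_insert_self _ _), fun q hq => hM _ ?_, fun q hq => hM _ ?_,
      fun q hq => hM _ ?_⟩ <;>
    simp only [Finset.mem_insert, Finset.mem_union, Finset.mem_image, Finset.mem_range]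
    · exact Or.inr (Or.inl (Or.inl ⟨q, hq, rfl⟩))
    · exact Or.inr (Or.inl (Or.inr ⟨q, hq, rfl⟩))
    · exact Or.inr (Or.inr ⟨q, hq, rfl⟩)
  have h2i : 0 < 2 ^ i := by positivity
  -- The window of copy `c` is centred at `4 * M * c`. The lines of the network are moved there, and
  -- the tangent at that point to the parabola `-(5 / 4) * x ^ 2` is added to all of them.
  set σ : ℕ → ℕ → ℝ := fun c t => 4 * M * c + τ t with hσ
  set α : ℕ × ℕ → ℝ := fun p => a p.2 - 10 * M * p.1 with hα
  set β : ℕ × ℕ → ℝ := fun p => b p.2 - 4 * M * p.1 * a p.2 + 20 * M ^ 2 * p.1 ^ 2 with hβ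
  have hline : ∀ c c₀ q t, α (c, q) * σ c₀ t + β (c, q) =
      5 * M * (4 * M * ((c : ℝ) - c₀) ^ 2 - 2 * ((c : ℝ) - c₀) * τ t) +
        (a q * (τ t - 4 * M * ((c : ℝ) - c₀)) + b q) + (- 10 * M * c₀ * τ t - 20 * M ^ 2 * c₀ ^ 2) := by
    intro c c₀ q t
    simp only [hα, hβ, hσ]
    ring
  set I : Finset (ℕ × ℕ) := Finset.range k ×ˢ Finset.range (2 ^ i) with hI
  have hIinj : Set.InjOn (fun p : ℕ × ℕ => E p.1 p.2) I := by
    rintro ⟨c, q⟩ hp ⟨c', q'⟩ hp' h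
    simp only [hI, Finset.coe_product, Finset.coe_range, Set.mem_prod, Set.mem_Iio] at hp hp'
    obtain ⟨rfl, rfl⟩ := hinj c hp.1 c' hp'.1 q hp.2 q' hp'.2 h
    rfl
  obtain ⟨W, hW⟩ := Finset.exists_le ((I ×ˢ I).image (fun p => α p.1 * σ p.2.1 p.2.2 + β p.1))
  set idx : Sym2 V → ℕ × ℕ := Function.invFunOn (fun p : ℕ × ℕ => E p.1 p.2) I with hidx
  set Core : Finset (Sym2 V) := I.image (fun p => E p.1 p.2) with hCore
  set slope : Sym2 V → ℝ := fun e => if e ∈ Core then α (idx e) else 0 with hslope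
  set icpt : Sym2 V → ℝ := fun e => if e ∈ Core then β (idx e) else W + 1 with hicpt
  have hmemI : ∀ c < k, ∀ q < 2 ^ i, (c, q) ∈ I := fun c hc q hq => by simp [hI, hc, hq]
  have hmem : ∀ c < k, ∀ q < 2 ^ i, E c q ∈ Core := fun c hc q hq =>
    Finset.mem_image.2 ⟨(c, q), hmemI c hc q hq, rfl⟩
  have hidxE : ∀ c < k, ∀ q < 2 ^ i, idx (E c q) = (c, q) := fun c hc q hq =>
    hIinj.leftInvOn_invFunOn (hmemI c hc q hq)
  have hslE : ∀ c < k, ∀ q < 2 ^ i, slope (E c q) = α (c, q) := fun c hc q hq => by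
    simp only [hslope, if_pos (hmem c hc q hq), hidxE c hc q hq]
  have hicE : ∀ c < k, ∀ q < 2 ^ i, icpt (E c q) = β (c, q) := fun c hc q hq => by
    simp only [hicpt, if_pos (hmem c hc q hq), hidxE c hc q hq]
  -- The requirements at the sample values are stable under small changes of the intercepts.
  have hev : ∀ᶠ y : Sym2 V → ℝ in 𝓝 icpt, ∀ p ∈ I,
      BottleneckOrder i (fun q => slope (E p.1 q) * σ p.1 p.2 + y (E p.1 q)) p.2 ∧
      ∀ f ∈ (Finset.univ : Finset (Sym2 V)), ∀ x ∈ Finset.range (2 ^ i), (∀ q < 2 ^ i, f ≠ E p.1 q) →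
        slope (E p.1 x) * σ p.1 p.2 + y (E p.1 x) < slope f * σ p.1 p.2 + y f := by
    rw [Filter.eventually_all_finset]
    rintro ⟨c, t⟩ hp
    obtain ⟨hc, ht⟩ : c < k ∧ t < 2 ^ i := by simpa [hI] using hp
    refine Filter.Eventually.and ?_ ?_
    · have hcont : Continuous (fun (y : Sym2 V → ℝ) (q : ℕ) =>
        slope (E c q) * σ c t + y (E c q)) := by fun_prop
      refine hcont.continuousAt.eventually_mem ((isOpen_bottleneckOrder i t).mem_nhds ?_)
      refine ((hu t ht).add_const (- 10 * M * c * τ t - 20 * M ^ 2 * c ^ 2)).congr ht ?_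
      intro q hq
      rw [hslE c hc q hq, hicE c hc q hq, hline]
      ring
    · rw [Filter.eventually_all_finset]
      intro f _
      rw [Filter.eventually_all_finset]
      intro x hx
      rw [Finset.mem_range] at hx
      by_cases hf : ∀ q < 2 ^ i, f ≠ E c q
      swap
      · exact Filter.Eventually.of_forall fun y h => absurd h hf
      have h0 : slope (E c x) * σ c t + icpt (E c x) < slope f * σ c t + icpt f := by
        rw [hslE c hc x hx, hicE c hc x hx]
        by_cases hfC : f ∈ Core
        · obtain ⟨⟨c', q⟩, hp', rfl⟩ := Finset.mem_image.1 hfC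
          obtain ⟨hc', hq⟩ : c' < k ∧ q < 2 ^ i := by simpa [hI] using hp'
          simp only
          rw [hslE c' hc' q hq, hicE c' hc' q hq, hline, hline]
          have hne : c' ≠ c := fun h => hf q hq (by rw [h])
          have hd : (1 : ℝ) ≤ |(c' : ℝ) - c| := by
            have : (1 : ℤ) ≤ |(c' : ℤ) - c| := Int.one_le_abs (by omega)
            exact_mod_cast this
          have := window_separation hM1 hd (hMτ t ht) (hMa x hx) (hMa q hq) (hMb x hx) (hMb q hq)
          simp only [sub_self, mul_zero, sub_zero]
          linarith
        · simp only [hslope, hicpt, if_neg hfC, zero_mul, zero_add]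
          have := hW _ (Finset.mem_image.2 ⟨((c, x), (c, t)), Finset.mem_product.2
            ⟨hmemI c hc x hx, hmemI c hc t ht⟩, rfl⟩)
          simp only at this
          linarith
      have hc1 : Continuous (fun y : Sym2 V → ℝ => slope (E c x) * σ c t + y (E c x)) := by fun_prop
      have hc2 : Continuous (fun y : Sym2 V → ℝ => slope f * σ c t + y f) := by fun_prop
      exact (hc1.continuousAt.eventually_lt hc2.continuousAt h0).mono fun y h _ => h
  obtain ⟨ε, hε, hball⟩ := Metric.eventually_nhds_iff.1 hev
  obtain ⟨y, hy1, hy2, hy3⟩ := exists_generic_intercepts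
    ((Set.toFinite G.edgeSet).toFinset) slope icpt
    ((Finset.range (k + 1) ×ˢ Finset.range (2 ^ i)).image (fun p => σ p.1 p.2))
    ⟨σ 0 0, Finset.mem_image.2 ⟨(0, 0), by simp, rfl⟩⟩ hε
  have hy := hball ((dist_pi_lt_iff hε).2 (fun e => by rw [Real.dist_eq]; exact hy1 e))
  refine ⟨⟨G, hG, slope, y⟩, σ, rfl, ?_, ?_, ?_, ?_, ?_⟩
  · intro t e he f hf g hg h hh
    exact hy3 t e (by simpa using he) f (by simpa using hf) g (by simpa using hg) h (by simpa using hh)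
  · intro c hc t ht
    have := hy2 (σ c t) (Finset.mem_image.2 ⟨(c, t), by simp; omega, rfl⟩)
    rw [Set.Finite.coe_toFinset] at this
    exact this
  · intro c t ht
    simp only [hσ]
    linarith [hτ t ht]
  · intro c
    have h1 := (abs_le.1 (hMτ (2 ^ i - 1) (by omega))).2
    have h2 := (abs_le.1 (hMτ 0 h2i)).1
    simp only [hσ]
    push_cast
    linarith
  · intro c hc t ht
    obtain ⟨h1, h2⟩ := hy (c, t) (hmemI c hc t ht)
    exact ⟨h1, fun f _ hf x hx => h2 f (Finset.mem_univ _) x (Finset.mem_range.2 hx) hf⟩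

/-- The admissible numbers of edges leave room for the edges of `S`, a star that makes the graph
connected, and arbitrary further edges. -/
lemma exists_connected_graph {n m : ℕ} (hn : 0 < n) (S : Finset (Sym2 (Fin n)))
    (hS : ∀ e ∈ S, ¬ e.IsDiag) (h1 : S.card + (n - 1) ≤ m) (h2 : m ≤ n.choose 2) :
    ∃ G : SimpleGraph (Fin n), G.Connected ∧ (∀ e ∈ S, e ∈ G.edgeSet) ∧ G.edgeSet.ncard = m := by
  classical
  set z : Fin n := ⟨0, hn⟩
  set Star : Finset (Sym2 (Fin n)) := (Finset.univ.erase z).image (fun v => s(z, v)) with hStar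
  have hcard : (S ∪ Star).card ≤ m := by
    refine (Finset.card_union_le _ _).trans (le_trans ?_ h1)
    gcongr
    exact Finset.card_image_le.trans (by simp)
  have hsub : S ∪ Star ⊆ (⊤ : SimpleGraph (Fin n)).edgeFinset := by
    intro e he
    rw [SimpleGraph.mem_edgeFinset, SimpleGraph.edgeSet_top]
    rcases Finset.mem_union.1 he with he | he
    · exact hS e he
    · obtain ⟨v, hv, rfl⟩ := Finset.mem_image.1 he
      simpa using (Finset.ne_of_mem_erase hv).symm
  obtain ⟨F, hF1, hF2, hF3⟩ := Finset.exists_subsuperset_card_eq hsub hcard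
    (by rw [SimpleGraph.card_edgeFinset_top_eq_card_choose_two, Fintype.card_fin]; exact h2)
  have hedge : (SimpleGraph.fromEdgeSet (F : Set (Sym2 (Fin n)))).edgeSet = F := by
    rw [SimpleGraph.edgeSet_fromEdgeSet, sdiff_eq_left, Set.disjoint_left]
    intro e he hd
    have := hF2 (Finset.mem_coe.1 he)
    rw [SimpleGraph.mem_edgeFinset, SimpleGraph.edgeSet_top] at this
    exact this hd
  refine ⟨SimpleGraph.fromEdgeSet F, ?_, ?_, ?_⟩
  · rw [SimpleGraph.connected_iff_exists_forall_reachable]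
    refine ⟨z, fun v => ?_⟩
    by_cases hv : v = z
    · rw [hv]
    · refine SimpleGraph.Adj.reachable ?_
      rw [← SimpleGraph.mem_edgeSet, hedge]
      exact hF1 (Finset.mem_union_right _ (Finset.mem_image.2 ⟨v, by simp [hv], rfl⟩))
  · intro e he
    rw [hedge]
    exact hF1 (Finset.mem_union_left _ he)
  · rw [hedge, Set.ncard_coe_finset, hF3]

/-- The translates by `c < k` of the network placed on the natural numbers are edge-disjoint. -/
theorem exists_copies {n j k : ℕ} (hj : 1 ≤ j) (hn : 0 < n) (hk : ∀ c < k, 9 * 4 ^ j + 1 + c < n) :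
    ∃ (μ : ℕ → List Bool → Fin n) (s t : ℕ → Fin n),
      (∀ c < k, ∀ q < 2 ^ (2 * j), ¬ (netEdge (2 * j) (μ c) (s c) (t c) q).IsDiag) ∧
      (∀ c < k, ∀ c' < k, ∀ q < 2 ^ (2 * j), ∀ q' < 2 ^ (2 * j),
        netEdge (2 * j) (μ c) (s c) (t c) q = netEdge (2 * j) (μ c') (s c') (t c') q' →
          c = c' ∧ q = q') ∧
      ∀ c < k, ∀ (χ : List Bool → Bool) (cs ct : Bool), ∃ col : Fin n → Bool, ∀ q < 2 ^ (2 * j),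
        Prod.map col col (ends (2 * j) (μ c) (s c) (t c) q) = ends (2 * j) χ cs ct q := by
  obtain ⟨μ, s, t, h1, h2, h3⟩ := exists_placement hj
  set φ : ℕ → ℕ → Fin n := fun c y => ⟨(y + c) % n, Nat.mod_lt _ hn⟩ with hφ
  have hval : ∀ c < k, ∀ y, y ≤ 9 * 4 ^ j + 1 → (φ c y : ℕ) = y + c := by
    intro c hc y hy
    exact Nat.mod_eq_of_lt (by have := hk c hc; omega)
  have hends : ∀ c q, ends (2 * j) (φ c ∘ μ) (φ c s) (φ c t) q =
      Prod.map (φ c) (φ c) (ends (2 * j) μ s t q) := fun c q => (map_ends _ _ _ _ _ _).symm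
  refine ⟨fun c => φ c ∘ μ, fun c => φ c s, fun c => φ c t, ?_, ?_, ?_⟩
  · intro c hc q hq
    obtain ⟨e1, e2, e3⟩ := h1 q hq
    simp only [netEdge, hends, Prod.map, Sym2.mk_isDiag_iff, Fin.ext_iff, hval c hc _ e1,
      hval c hc _ e2]
    omega
  · intro c hc c' hc' q hq q' hq' h
    obtain ⟨e1, e2, e3⟩ := h1 q hq
    obtain ⟨e1', e2', e3'⟩ := h1 q' hq'
    simp only [netEdge, hends, Prod.map, Sym2.eq_iff, Fin.ext_iff, hval c hc _ e1,
      hval c hc _ e2, hval c' hc' _ e1', hval c' hc' _ e2'] at h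
    have hqq : q = q' := by
      refine h2 q hq q' hq' ?_
      unfold Nat.dist
      omega
    subst hqq
    exact ⟨by omega, rfl⟩
  · intro c hc χ cs ct
    obtain ⟨col, hcol⟩ := h3 χ cs ct
    refine ⟨fun v => col (v - c), fun q hq => ?_⟩
    obtain ⟨e1, e2, -⟩ := h1 q hq
    rw [← hcol q hq, hends]
    simp only [Prod.map, hval c hc _ e1, hval c hc _ e2, Nat.add_sub_cancel]

/-- A connected graph with `n` vertices and `m` edges that contains `k` edge-disjoint copies of the
network of depth `2 * j` can be labelled so that each copy contributes its `j * 4 ^ (j - 1)` exchanges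
of edges to the number of minimum spanning trees. -/
theorem exists_parametricGraph {n m j k : ℕ} (hj : 1 ≤ j) (hn : 0 < n)
    (hk : ∀ c < k, 9 * 4 ^ j + 1 + c < n) (h1 : k * 4 ^ j + (n - 1) ≤ m) (h2 : m ≤ n.choose 2) :
    ∃ P : ParametricGraph (Fin n), P.graph.edgeSet.ncard = m ∧
      k * (j * 4 ^ (j - 1)) + 1 ≤ P.minSpanningTrees.ncard := by
  classical
  obtain ⟨μ, s, t, hdiag, hinj, hcol⟩ := exists_copies hj hn hk
  have h4 : 2 ^ (2 * j) = 4 ^ j := by rw [pow_mul]; norm_num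
  set N := 2 ^ (2 * j) with hN
  have hNpos : 0 < N := by positivity
  set E : ℕ → ℕ → Sym2 (Fin n) := fun c q => netEdge (2 * j) (μ c) (s c) (t c) q with hE
  set S : Finset (Sym2 (Fin n)) := (Finset.range k ×ˢ Finset.range N).image (fun p => E p.1 p.2)
  obtain ⟨G, hG, hSG, hGm⟩ := exists_connected_graph hn S
    (by
      intro e he
      obtain ⟨⟨c, q⟩, hp, rfl⟩ := Finset.mem_image.1 he
      obtain ⟨hc, hq⟩ : c < k ∧ q < N := by simpa using hp
      exact hdiag c hc q hq)
    (le_trans (Nat.add_le_add_right (Finset.card_image_le.trans (by simp [h4])) _) h1) h2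
  have hEG : ∀ c < k, ∀ q < N, E c q ∈ G.edgeSet := fun c hc q hq =>
    hSG _ (Finset.mem_image.2 ⟨(c, q), by simp [hc, hq], rfl⟩)
  obtain ⟨P, σ, hPG, hgen, hnt, hmono, hnext, hwin⟩ := exists_weights hG (2 * j) k E hinj
  refine ⟨P, by rw [hPG]; exact hGm, ?_⟩
  have hiff : ∀ c < k, ∀ u < N, ∀ x < N,
      (E c x ∈ (P.treeAt (σ c u)).edgeSet ↔ InTree (2 * j) u x) := by
    intro c hc u hu x hx
    obtain ⟨hb, hl⟩ := hwin c hc u hu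
    refine netEdge_mem_kruskalTree_iff hu hx hb ?_ ?_ (hcol c hc)
    · rw [hPG]; exact hEG c hc
    · rw [hPG]
      intro f hf hlt
      by_contra! hcon
      exact lt_asymm hlt (hl f hf hcon x hx)
  -- The sample values are numbered consecutively: number `c * N + u` is time `u` of copy `c`.
  have hsum := ParametricGraph.sum_ncard_diff_lt_ncard_minSpanningTrees hgen
    (fun r => σ (r / N) (r % N)) (k * N - 1)
    (fun r hr => hnt _ (by
      have : r / N ≤ k := Nat.div_le_of_le_mul (by rw [mul_comm]; omega)
      exact this) _ (Nat.mod_lt _ hNpos))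
    (fun r _ => by
      have hmod := Nat.mod_lt r hNpos
      have hdm := Nat.div_add_mod r N
      by_cases hlast : r % N + 1 < N
      · have e1 : (r + 1) / N = r / N := by
          refine Nat.div_eq_of_lt_le ?_ ?_
          · rw [mul_comm]; omega
          · rw [mul_comm, mul_add]; omega
        have e2 : (r + 1) % N = r % N + 1 := by
          have := Nat.div_add_mod (r + 1) N
          rw [e1] at this; omega
        rw [e1, e2]
        exact hmono _ _ hlast
      · have e0 : r % N = N - 1 := by omega
        have e1 : (r + 1) / N = r / N + 1 := by
          refine Nat.div_eq_of_lt_le ?_ ?_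
          · rw [mul_comm, mul_add]; omega
          · rw [mul_comm, mul_add, mul_add]; omega
        have e2 : (r + 1) % N = 0 := by
          have := Nat.div_add_mod (r + 1) N
          rw [e1, Nat.mul_add, mul_one] at this; omega
        rw [e1, e2, e0]
        exact hnext _)
  refine le_trans (Nat.add_le_add_right ?_ 1) hsum
  -- Only the steps within a copy are counted; what happens between the windows is dropped.
  set d : ℕ → ℕ := fun r => ((P.treeAt (σ (r / N) (r % N))).edgeSet \
    (P.treeAt (σ ((r + 1) / N) ((r + 1) % N))).edgeSet).ncard with hd
  have hcopy : ∀ c < k, (leaving (2 * j)).card ≤ ∑ u ∈ Finset.range (N - 1), d (c * N + u) := by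
    intro c hc
    rw [leaving, Finset.card_sigma]
    refine Finset.sum_le_sum fun u hu => ?_
    rw [Finset.mem_range] at hu
    have hu' : u + 1 < N := by omega
    have e1 : ∀ w < N, (c * N + w) / N = c ∧ (c * N + w) % N = w := fun w hw => by
      rw [mul_comm, Nat.mul_add_div hNpos, Nat.div_eq_of_lt hw, Nat.mul_add_mod,
        Nat.mod_eq_of_lt hw]
      simp
    simp only [hd]
    rw [(e1 u (by omega)).1, (e1 u (by omega)).2, add_assoc, (e1 _ hu').1, (e1 _ hu').2]
    rw [← Finset.card_image_of_injOn (f := E c), ← Set.ncard_coe_finset]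
    · refine Set.ncard_le_ncard ?_ (Set.toFinite _)
      intro e he
      obtain ⟨x, hx, rfl⟩ := Finset.mem_image.1 (Finset.mem_coe.1 he)
      obtain ⟨hx1, hx2, hx3⟩ : x < N ∧ InTree (2 * j) u x ∧ ¬ InTree (2 * j) (u + 1) x := by
        simpa using hx
      exact ⟨(hiff c hc u (by omega) x hx1).2 hx2, fun h => hx3 ((hiff c hc _ hu' x hx1).1 h)⟩
    · intro x hx x' hx' h
      have l1 : x < N := (Finset.mem_range.1 (Finset.mem_filter.1 hx).1)
      have l2 : x' < N := (Finset.mem_range.1 (Finset.mem_filter.1 hx').1)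
      exact (hinj c hc c hc x l1 x' l2 h).2
  calc k * (j * 4 ^ (j - 1)) = ∑ c ∈ Finset.range k, j * 4 ^ (j - 1) := by simp
    _ ≤ ∑ c ∈ Finset.range k, ∑ u ∈ Finset.range (N - 1), d (c * N + u) :=
      Finset.sum_le_sum fun c hc => (card_leaving j).trans (hcopy c (Finset.mem_range.1 hc))
    _ = ∑ p ∈ Finset.range k ×ˢ Finset.range (N - 1), d (p.1 * N + p.2) :=
      (Finset.sum_product' _ _ (fun c u => d (c * N + u))).symm
    _ = ∑ r ∈ (Finset.range k ×ˢ Finset.range (N - 1)).image (fun p => p.1 * N + p.2), d r := by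
      rw [Finset.sum_image]
      rintro ⟨c, u⟩ hp ⟨c', u'⟩ hp' h
      simp only [Finset.coe_product, Finset.coe_range, Set.mem_prod, Set.mem_Iio] at hp hp' h
      have hu : u < N := by omega
      have hu' : u' < N := by omega
      have l1 : (c * N + u) / N = c := by
        rw [mul_comm, Nat.mul_add_div hNpos, Nat.div_eq_of_lt hu, add_zero]
      have l2 : (c' * N + u') / N = c' := by
        rw [mul_comm, Nat.mul_add_div hNpos, Nat.div_eq_of_lt hu', add_zero]
      have l3 : c = c' := by rw [← l1, ← l2, h]
      subst l3
      simp only [Prod.mk.injEq, true_and]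
      omega
    _ ≤ ∑ r ∈ Finset.range (k * N - 1), d r := by
      refine Finset.sum_le_sum_of_subset fun r hr => ?_
      obtain ⟨⟨c, u⟩, hp, rfl⟩ := Finset.mem_image.1 hr
      obtain ⟨hc, hu⟩ : c < k ∧ u < N - 1 := by simpa using hp
      rw [Finset.mem_range]
      have : (c + 1) * N ≤ k * N := Nat.mul_le_mul_right _ hc
      have e : (c + 1) * N = c * N + N := by ring
      simp only
      omega

end Assembly

/-! ### The count -/

lemma mul_log_le_one {n m : ℕ} (h80 : n < 80) (h2 : m ≤ n.choose 2) :
    1 / 1000000 * (m : ℝ) * Real.log n ≤ 1 := by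
  have h3 : (n.choose 2 : ℝ) ≤ 80 * 80 := by
    have h4 : n.choose 2 ≤ n ^ 2 := Nat.choose_le_pow n 2
    have h5 : n.choose 2 ≤ 80 * 80 := by nlinarith
    exact_mod_cast h5
  have hm : (m : ℝ) ≤ 80 * 80 := le_trans (by exact_mod_cast h2) h3
  have hlog : Real.log n ≤ 80 :=
    (Real.log_le_self (Nat.cast_nonneg n)).trans (by exact_mod_cast h80.le)
  have hlog0 : 0 ≤ Real.log n := Real.log_natCast_nonneg n
  have := mul_le_mul hm hlog hlog0 (by norm_num)
  linarith

/-- The order `20 * 4 ^ j ≤ n < 80 * 4 ^ j` of magnitude of a single copy. -/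
lemma exists_scale {n : ℕ} (h80 : 80 ≤ n) :
    ∃ j, 1 ≤ j ∧ 20 * 4 ^ j ≤ n ∧ n < 80 * 4 ^ j := by
  have h20 : n / 20 ≠ 0 := by omega
  refine ⟨Nat.log 4 (n / 20), Nat.log_pos (by norm_num) (by omega), ?_, ?_⟩
  · have := Nat.pow_log_le_self 4 h20
    omega
  · have := Nat.lt_pow_succ_log_self (b := 4) (by norm_num) (n / 20)
    rw [pow_succ] at this
    omega

lemma log_le_of_lt_scale {n j : ℕ} (hn : 0 < n) (hj : 1 ≤ j) (h : n < 80 * 4 ^ j) :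
    Real.log n ≤ 10 * j := by
  have h1 : (n : ℝ) ≤ 4 ^ (j + 4) := by
    have : n ≤ 4 ^ (j + 4) := by rw [pow_add]; omega
    exact_mod_cast this
  have h2 : Real.log n ≤ (j + 4 : ℕ) * Real.log 4 := by
    rw [← Real.log_pow]
    exact Real.log_le_log (by exact_mod_cast hn) h1
  have h3 : Real.log 4 ≤ 2 := by
    have : (4 : ℝ) = 2 ^ 2 := by norm_num
    rw [this, Real.log_pow]
    have := Real.log_two_lt_d9
    push_cast
    linarith
  have h4 : (1 : ℝ) ≤ j := by exact_mod_cast hj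
  push_cast at h2
  nlinarith

/-- The number `k` of copies of size `q` fitting both the vertices and the edges; together the
copies use a constant fraction of the edges. -/
lemma exists_copy_count {n m q : ℕ} (hq4 : 4 ≤ q) (h20 : 20 * q ≤ n) (h80 : n < 80 * q)
    (h1 : 2 * n ≤ m + 3) (h2 : m ≤ n.choose 2) :
    ∃ k, (∀ c < k, 9 * q + 1 + c < n) ∧ k * q + (n - 1) ≤ m ∧ m ≤ 200 * (k * q) := by
  have hk := Nat.div_add_mod (m - (n - 1)) q
  have hk' := Nat.mod_lt (m - (n - 1)) (show 0 < q by omega)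
  set a := (m - (n - 1)) / q
  have hc : m * 2 ≤ n * (n - 1) := by
    rw [Nat.choose_two_right] at h2
    have := Nat.div_mul_le_self (n * (n - 1)) 2
    omega
  rcases le_total a (n / 2 - 1) with h | h
  · refine ⟨a, fun c hc => by omega, ?_, ?_⟩
    · rw [mul_comm a q]; omega
    · rw [mul_comm a q]
      have : q ≤ q * a := by
        refine Nat.le_mul_of_pos_right q (Nat.pos_of_ne_zero fun h0 => ?_)
        rw [h0] at hk; omega
      omega
  · refine ⟨n / 2 - 1, fun c hc => by omega, ?_, ?_⟩
    · have := Nat.mul_le_mul_left q h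
      rw [mul_comm _ q]; omega
    · have h3 : n ≤ 3 * (n / 2 - 1) := by omega
      have h4 : n * (n - 1) ≤ (3 * (n / 2 - 1)) * (80 * q) := Nat.mul_le_mul h3 (by omega)
      nlinarith

theorem mainTheorem1 :
    ∃ C : ℝ, 0 < C ∧
      ∀ n m : ℕ, 0 < n → 2 * (n : ℤ) - 3 ≤ (m : ℤ) → m ≤ n.choose 2 →
        ∃ P : ParametricGraph (Fin n),
          P.graph.edgeSet.ncard = m ∧
          C * (m : ℝ) * Real.log (n : ℝ) ≤ (P.minSpanningTrees.ncard : ℝ) := by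
  refine ⟨1 / 1000000, by norm_num, fun n m hn h1 h2 => ?_⟩
  rcases lt_or_ge n 80 with h80 | h80
  · -- Finitely many `n`: a single tree is enough, and the graph contains no copy at all.
    obtain ⟨P, hP, hcount⟩ := exists_parametricGraph (j := 1) (k := 0) le_rfl hn (by simp)
      (by omega) h2
    refine ⟨P, hP, (mul_log_le_one h80 h2).trans ?_⟩
    exact_mod_cast (by omega : 1 ≤ P.minSpanningTrees.ncard)
  · obtain ⟨j, hj, hlow, hup⟩ := exists_scale h80
    obtain ⟨k, hk1, hk2, hk3⟩ := exists_copy_count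
      (Nat.le_self_pow (by omega) 4) hlow hup (by omega) h2
    obtain ⟨P, hP, hcount⟩ := exists_parametricGraph hj hn hk1 hk2 h2
    refine ⟨P, hP, ?_⟩
    have hpow : 4 ^ j = 4 * 4 ^ (j - 1) := by
      rw [← pow_succ', Nat.sub_add_cancel hj]
    have hm : (m : ℝ) ≤ 800 * (k * 4 ^ (j - 1)) := by
      have : m ≤ 800 * (k * 4 ^ (j - 1)) := by rw [hpow] at hk3; linarith
      exact_mod_cast this
    have hlog := log_le_of_lt_scale hn hj hup
    have hc : (k : ℝ) * (j * 4 ^ (j - 1)) + 1 ≤ P.minSpanningTrees.ncard := by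
      exact_mod_cast hcount
    have hprod := mul_le_mul hm hlog (Real.log_natCast_nonneg n) (by positivity)
    have h0 : (0 : ℝ) ≤ k * (j * 4 ^ (j - 1)) := by positivity
    linarith
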